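/- **Setting.** Fix a first-order language with variables $x,y,z,\dots$ (countably many), arbitrary function symbols, finitely many ordinary predicate symbols $Q$ and finitely many inductive predicate symbols $P$. Formulas are only equations $t=u$ and atomic formulas $Q(\vec t)$, $P(\vec t)$. A *production* consists of finitely many atomic assumptions $Q_1(\vec u_1),\dots,Q_h(\vec u_h),P_{j_1}(\vec t_1),\dots,P_{j_m}(\vec t_m)$ and a conclusion $P_i(\vec t)$; an inductive definition set is a finite set of productions. Sequents $\Gamma\vdash\Delta$ are pairs of finite sets of formulas. The rules are: * (Axiom) $\Gamma\vdash\Delta$ if $\Gamma\cap\Delta\ne\emptyset$; * (Weak) from $\Gamma'\vdash\Delta'$ infer $\Gamma\vdash\Delta$ if $\Gamma'\subseteq\Gamma$, $\Delta'\subseteq\Delta$; * (Cut) from $\Gamma\vdash\varphi,\Delta$ and $\Gamma,\varphi\vdash\Delta$ infer $\Gamma\vdash\Delta$; * (Subst) from $\Gamma\vdash\Delta$ infer $\Gamma[\theta]\vdash\Delta[\theta]$; * ($=$L) from $\Gamma[x:=u,y:=t],\,t=u\vdash\Delta[x:=u,y:=t]$ infer $\Gamma[x:=t,y:=u],\,t=u\vdash\Delta[x:=t,y:=u]$;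 * ($=$R) $\Gamma\vdash t=t,\Delta$; * for each production, ($P_i$R): from all sequents $\Gamma\vdash\psi[\theta],\Delta$, with $\psi$ an assumption of the production, infer $\Gamma\vdash P_i(\vec t)[\theta],\Delta$; * (Case $P_i$): infer $\Gamma,P_i(\vec u)\vdash\Delta$ from the following premises, one for each production with conclusion $P_i(\vec t)$: rename the variables of the production to distinct fresh variables $\vec y$, and add to $\Gamma$ the equations $\vec u=\vec t(\vec y)$ and the renamed assumptions of the production. The renamed inductive assumptions are the *case-descendants* of $P_i(\vec u)$. A $\mathrm{CBase}^\omega$ *pre-proof* is a finite derivation tree over these rules, in which some leaves (*buds*) may be unjustified, together with a map that sends each bud to a non-bud node (its companion) labelled with the same sequent. Its *tree-unfolding* is the possibly infinite tree obtained by repeatedly continuing at each bud as at its companion. A *trace* following an infinite path $(\Gamma_i\vdash\Delta_i)_i$ is a sequence of inductive atomic formulas $\tau_i\in\Gamma_i$ such that: $\tau_i=\tau_{i+1}[\theta]$ at (Subst) with $\theta$; at ($=$L), $\tau_i=\varphi[x:=t,y:=u]$ and $\tau_{i+1}=\varphi[x:=u,y:=t]$ for some $\varphi$; at (Case), either $\tau_i$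 is the principal formula and $\tau_{i+1}$ is a case-descendant of it in the premise taken (a *progress point*), or $\tau_{i+1}=\tau_i$; and $\tau_{i+1}=\tau_i$ at all other rules. The pre-proof is a *proof* if every infinite path of its tree-unfolding has a tail followed by a trace with infinitely many progress points; it is *cut-free* if (Cut) is not used. A sequent is (cut-free) provable in $\mathrm{CBase}^\omega$ if it is the root sequent of a (cut-free) proof. **Theorem 1.** Let $s\neq e$ be constant symbols, $\mathrm{next}$ a unary function symbol, and $\mathrm{TeF}$, $\mathrm{FsT}$ unary inductive predicate symbols whose productions are exactly $$\frac{}{\mathrm{TeF}(e)}\qquad\frac{\mathrm{TeF}(\mathrm{next}\,x)}{\mathrm{TeF}(x)}\qquad\frac{}{\mathrm{FsT}(s)}\qquad\frac{\mathrm{FsT}(x)}{\mathrm{FsT}(\mathrm{next}\,x)}$$ (the language and the inductive definition set may or may not contain further symbols and further productions for other predicates). Then: 1. $\mathrm{TeF}(s)\vdash\mathrm{FsT}(e)$ is provable in $\mathrm{CBase}^\omega$. 2. $\mathrm{TeF}(s)\vdash\mathrm{FsT}(e)$ is not cut-free provable in $\mathrm{CBase}^\omega$. -/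

import Mathlib

open FirstOrder

universe u v w

namespace CyclicBase

/-- A language of the base system: function symbols, finitely many ordinary predicate symbols
(`Relations`) and finitely many inductive predicate symbols (`Ind`), each with an arity. -/
structure BaseLanguage extends FirstOrder.Language.{u, v} where
  Ind : ℕ → Type w
  finite_ordinary : Finite (Σ n, Relations n)
  finite_inductive : Finite (Σ n, Ind n)

/-- Terms over the countable supply `ℕ` of variables. -/
abbrev Tm (B : BaseLanguage.{u, v, w}) : Type u := B.toLanguage.Term ℕ

/-- Simultaneous substitutions. Variables that are not to be replaced are sent to themselves. -/
abbrev Substitution (B : BaseLanguage.{u, v, w}) : Type u := ℕ → Tm B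

/-- An atomic formula `R(t₁, …, tₙ)` whose predicate symbol is taken from the family `R`. -/
structure Atom (B : BaseLanguage.{u, v, w}) (R : ℕ → Type*) where
  arity : ℕ
  sym : R arity
  args : Fin arity → Tm B

namespace Atom

variable {B : BaseLanguage.{u, v, w}} {R : ℕ → Type*}

/-- The predicate symbol, together with its arity. -/
def symbol (A : Atom B R) : Σ n, R n := ⟨A.arity, A.sym⟩

def subst (θ : Substitution B) (A : Atom B R) : Atom B R :=
  ⟨A.arity, A.sym, fun i => (A.args i).subst θ⟩

def vars (A : Atom B R) : Finset ℕ := Finset.univ.biUnion fun i => (A.args i).varFinset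

/-- The list of arguments. -/
def argList (A : Atom B R) : List (Tm B) := List.ofFn A.args

end Atom

abbrev OrdAtom (B : BaseLanguage.{u, v, w}) := Atom B B.Relations

abbrev IndAtom (B : BaseLanguage.{u, v, w}) := Atom B B.Ind

/-- Formulas: equations, ordinary atomic formulas, inductive atomic formulas. -/
inductive Formula (B : BaseLanguage.{u, v, w})
  | eq (t s : Tm B)
  | ord (A : OrdAtom B)
  | ind (A : IndAtom B)

namespace Formula

variable {B : BaseLanguage.{u, v, w}}

noncomputable instance : DecidableEq (Formula B) := Classical.decEq _

def subst (θ : Substitution B) : Formula B → Formula B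
  | eq t s => eq (t.subst θ) (s.subst θ)
  | ord A => ord (A.subst θ)
  | ind A => ind (A.subst θ)

/-- The free variables of a formula. -/
def vars : Formula B → Finset ℕ
  | eq t s => t.varFinset ∪ s.varFinset
  | ord A => A.vars
  | ind A => A.vars

end Formula

/-- `Γ[θ]`. -/
noncomputable def substSet {B : BaseLanguage.{u, v, w}} (θ : Substitution B)
    (Γ : Finset (Formula B)) : Finset (Formula B) := Γ.image (Formula.subst θ)

/-- `FV(Γ)`. -/
def varsSet {B : BaseLanguage.{u, v, w}} (Γ : Finset (Formula B)) : Finset ℕ :=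
  Γ.biUnion Formula.vars

/-- Sequents `ante ⊢ succ`. -/
@[ext]
structure Sequent (B : BaseLanguage.{u, v, w}) where
  ante : Finset (Formula B)
  succ : Finset (Formula B)

/-- A production: ordinary assumptions, inductive assumptions, and the conclusion. -/
@[ext]
structure Production (B : BaseLanguage.{u, v, w}) where
  ordAsm : List (OrdAtom B)
  indAsm : List (IndAtom B)
  concl : IndAtom B

namespace Production

variable {B : BaseLanguage.{u, v, w}}

/-- All assumptions of the production, as formulas, under a substitution. -/
def asm (p : Production B) (θ : Substitution B) : List (Formula B) :=
  p.ordAsm.map (fun A => Formula.ord (A.subst θ)) ++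
    p.indAsm.map (fun A => Formula.ind (A.subst θ))

/-- The variables occurring in the production. -/
def vars (p : Production B) : Set ℕ :=
  {x | (∃ A ∈ p.ordAsm, x ∈ A.vars) ∨ (∃ A ∈ p.indAsm, x ∈ A.vars) ∨ x ∈ p.concl.vars}

/-- The formulas that a case distinction for `A` along this production, with variables renamed
by `ρ`, adds to the antecedent: the equations `u = t(y)` and the assumptions. -/
noncomputable def caseFormulas (p : Production B) (ρ : ℕ → ℕ) (A : IndAtom B) :
    Finset (Formula B) :=
  (List.zipWith Formula.eq A.argList
      (p.concl.subst fun x => Language.Term.var (ρ x)).argList).toFinset ∪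
    (p.asm fun x => Language.Term.var (ρ x)).toFinset

end Production

/-- Inductive definition sets. -/
abbrev IndDefSet (B : BaseLanguage.{u, v, w}) := Finset (Production B)

/-- The productions of `Φ` for the inductive predicate symbol `P`. -/
def productionsFor {B : BaseLanguage.{u, v, w}} (Φ : IndDefSet B) (P : Σ n, B.Ind n) :
    Set (Production B) := {p | p ∈ Φ ∧ p.concl.symbol = P}

/-- Rule applications. Each constructor is one inference rule; its arguments are the data that
determine the premises and the conclusion (and hence the principal formula, the substitution, …).
* `ax`, `weak`, `cut`, `subst`, `eqLa`, `eqR` are the structural and equality rules;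
* `indR` is the right rule of a production `p` instantiated by `θ`;
* `case` is the case rule with principal formula `A`; the list `cs` enumerates the productions for
  the predicate of `A`, each with the choice of the fresh variables. -/
inductive RuleApp (B : BaseLanguage.{u, v, w})
  | ax (Γ Δ : Finset (Formula B))
  | weak (Γ' Δ' Γ Δ : Finset (Formula B))
  | cut (Γ Δ : Finset (Formula B)) (φ : Formula B)
  | subst (Γ Δ : Finset (Formula B)) (θ : Substitution B)
  | eqLa (Γ Δ : Finset (Formula B)) (x y : ℕ) (t s : Tm B)
  | eqR (Γ Δ : Finset (Formula B)) (t : Tm B)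
  | indR (Γ Δ : Finset (Formula B)) (p : Production B) (θ : Substitution B)
  | case (Γ Δ : Finset (Formula B)) (A : IndAtom B) (cs : List (Production B × (ℕ → ℕ)))

/-- The substitution `[x := t, y := s]`. -/
def subst₂ {B : BaseLanguage.{u, v, w}} (x y : ℕ) (t s : Tm B) : Substitution B :=
  fun z => if z = x then t else if z = y then s else Language.Term.var z

namespace RuleApp

variable {B : BaseLanguage.{u, v, w}}

/-- The conclusion of a rule application. -/
noncomputable def conclusion : RuleApp B → Sequent B
  | ax Γ Δ => ⟨Γ, Δ⟩
  | weak _ _ Γ Δ => ⟨Γ, Δ⟩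
  | cut Γ Δ _ => ⟨Γ, Δ⟩
  | subst Γ Δ θ => ⟨substSet θ Γ, substSet θ Δ⟩
  | eqLa Γ Δ x y t s =>
      ⟨insert (Formula.eq t s) (substSet (subst₂ x y t s) Γ), substSet (subst₂ x y t s) Δ⟩
  | eqR Γ Δ t => ⟨Γ, insert (Formula.eq t t) Δ⟩
  | indR Γ Δ p θ => ⟨Γ, insert (Formula.ind (p.concl.subst θ)) Δ⟩
  | case Γ Δ A _ => ⟨insert (Formula.ind A) Γ, Δ⟩

/-- The list of premises (assumptions) of a rule application. -/
noncomputable def premises : RuleApp B → List (Sequent B)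
  | ax _ _ => []
  | weak Γ' Δ' _ _ => [⟨Γ', Δ'⟩]
  | cut Γ Δ φ => [⟨Γ, insert φ Δ⟩, ⟨insert φ Γ, Δ⟩]
  | subst Γ Δ _ => [⟨Γ, Δ⟩]
  | eqLa Γ Δ x y t s =>
      [⟨insert (Formula.eq t s) (substSet (subst₂ x y s t) Γ), substSet (subst₂ x y s t) Δ⟩]
  | eqR _ _ _ => []
  | indR Γ Δ p θ => (p.asm θ).map fun φ => ⟨Γ, insert φ Δ⟩
  | case Γ Δ A cs => cs.map fun c => ⟨Γ ∪ c.1.caseFormulas c.2 A, Δ⟩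

/-- The side conditions of the rules, for the inductive definition set `Φ`. -/
def Valid (Φ : IndDefSet B) : RuleApp B → Prop
  | ax Γ Δ => (Γ ∩ Δ).Nonempty
  | weak Γ' Δ' Γ Δ => Γ' ⊆ Γ ∧ Δ' ⊆ Δ
  | cut _ _ _ => True
  | subst _ _ _ => True
  | eqLa _ _ x y _ _ => x ≠ y
  | eqR _ _ _ => True
  | indR _ _ p _ => p ∈ Φ
  | case Γ Δ A cs =>
      (cs.map Prod.fst).Nodup ∧
      (∀ p, p ∈ cs.map Prod.fst ↔ p ∈ productionsFor Φ A.symbol) ∧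
      ∀ c ∈ cs, Set.InjOn c.2 c.1.vars ∧
        ∀ x ∈ c.1.vars, c.2 x ∉ varsSet (insert (Formula.ind A) (Γ ∪ Δ))

def IsCut : RuleApp B → Prop
  | cut _ _ _ => True
  | _ => False

/-- `r.Progress n τ τ'`: the rule is a case rule with principal formula `τ`, and `τ'` is a
case-descendant of `τ` in the `n`-th premise. -/
def Progress (r : RuleApp B) (n : ℕ) (τ τ' : Formula B) : Prop :=
  match r with
  | case _ _ A cs => τ = Formula.ind A ∧ ∃ c, cs[n]? = some c ∧
      ∃ A' ∈ c.1.indAsm, τ' = Formula.ind (A'.subst fun x => Language.Term.var (c.2 x))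
  | _ => False

/-- `r.TraceStep n τ τ'`: a trace at `τ` in the conclusion may continue with `τ'` in the `n`-th
premise of the rule application `r`. -/
def TraceStep (r : RuleApp B) (n : ℕ) (τ τ' : Formula B) : Prop :=
  match r with
  | subst _ _ θ => τ = τ'.subst θ
  | eqLa _ _ x y t s =>
      ∃ φ : Formula B, τ = φ.subst (subst₂ x y t s) ∧ τ' = φ.subst (subst₂ x y s t)
  | case Γ Δ A cs => (case Γ Δ A cs).Progress n τ τ' ∨ τ' = τ
  | _ => τ' = τ

end RuleApp

/-- Labelled trees: partial functions from finite sequences of natural numbers. The label of a node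
is its sequent and either a rule application (`some r`) or the label of a bud (`none`). -/
abbrev LTree (B : BaseLanguage.{u, v, w}) := List ℕ → Option (Sequent B × Option (RuleApp B))

namespace LTree

variable {B : BaseLanguage.{u, v, w}}

def dom (D : LTree B) : Set (List ℕ) := {σ | (D σ).isSome}

/-- The sequent at a node. -/
def sequentAt (D : LTree B) (σ : List ℕ) : Option (Sequent B) := (D σ).map Prod.fst

def IsBud (D : LTree B) (σ : List ℕ) : Prop := ∃ S, D σ = some (S, none)

def IsInner (D : LTree B) (σ : List ℕ) : Prop := ∃ S r, D σ = some (S, some r)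

/-- Derivation trees over `Φ`. The children of an inner node are exactly the premises of the
rule application at that node. -/
structure IsDerivationTree (Φ : IndDefSet B) (D : LTree B) : Prop where
  prefix_closed : ∀ σ₁ σ₂, σ₁ ++ σ₂ ∈ D.dom → σ₁ ∈ D.dom
  sibling_closed : ∀ σ n m, σ ++ [n] ∈ D.dom → m ≤ n → σ ++ [m] ∈ D.dom
  bud : ∀ σ S, D σ = some (S, none) → σ ++ [0] ∉ D.dom
  inner : ∀ σ S r, D σ = some (S, some r) → r.Valid Φ ∧ r.conclusion = S ∧
    ∀ n, D.sequentAt (σ ++ [n]) = r.premises[n]?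

/-- `σ 0, σ 1, …` is an infinite path of nodes, where `d i` is the direction taken at `σ i`. -/
def IsInfinitePath (D : LTree B) (σ : ℕ → List ℕ) (d : ℕ → ℕ) : Prop :=
  ∀ i, σ i ∈ D.dom ∧ σ (i + 1) = σ i ++ [d i]

/-- `τ` is a trace following the infinite path `σ` with directions `d`. -/
def IsTrace (D : LTree B) (σ : ℕ → List ℕ) (d : ℕ → ℕ) (τ : ℕ → Formula B) : Prop :=
  ∀ i, ∃ S r, D (σ i) = some (S, some r) ∧
    (∃ A, τ i = Formula.ind A) ∧ τ i ∈ S.ante ∧ r.TraceStep (d i) (τ i) (τ (i + 1))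

/-- The formula at position `i` is a progress point of the trace `τ`. -/
def IsProgressPoint (D : LTree B) (σ : ℕ → List ℕ) (d : ℕ → ℕ) (τ : ℕ → Formula B) (i : ℕ) :
    Prop :=
  ∃ S r, D (σ i) = some (S, some r) ∧ r.Progress (d i) (τ i) (τ (i + 1))

/-- Every infinite path has a tail that is followed by a trace with infinitely many progress
points. -/
def GlobalTraceCondition (D : LTree B) : Prop :=
  ∀ σ d, D.IsInfinitePath σ d → ∃ k τ,
    D.IsTrace (fun i => σ (k + i)) (fun i => d (k + i)) τ ∧
    ∀ N, ∃ i ≥ N, D.IsProgressPoint (fun i => σ (k + i)) (fun i => d (k + i)) τ i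

end LTree

/-- Cyclic pre-proofs: a finite (nonempty) derivation tree with a map that sends each bud to an
inner node carrying the same sequent. -/
structure PreProof (B : BaseLanguage.{u, v, w}) (Φ : IndDefSet B) where
  tree : LTree B
  isDerivationTree : tree.IsDerivationTree Φ
  finite_dom : tree.dom.Finite
  root_mem : [] ∈ tree.dom
  companion : List ℕ → List ℕ
  companion_spec : ∀ σ, tree.IsBud σ →
    tree.IsInner (companion σ) ∧ tree.sequentAt (companion σ) = tree.sequentAt σ

namespace PreProof

variable {B : BaseLanguage.{u, v, w}} {Φ : IndDefSet B}

/-- Replace a bud by its companion, and keep an inner node. -/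
noncomputable def resolve (P : PreProof B Φ) (σ : List ℕ) : Option (List ℕ) :=
  match P.tree σ with
  | none => none
  | some (_, some _) => some σ
  | some (_, none) => some (P.companion σ)

/-- The inner node of the finite tree that is reached by following the directions `σ` from the
root and jumping to the companion at each bud. -/
noncomputable def position (P : PreProof B Φ) (σ : List ℕ) : Option (List ℕ) :=
  σ.foldl (fun ν n => ν.bind fun μ => P.resolve (μ ++ [n])) (P.resolve [])

/-- The tree-unfolding of a pre-proof. -/
noncomputable def unfolding (P : PreProof B Φ) : LTree B :=
  fun σ => (P.position σ).bind P.tree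

/-- A pre-proof is a proof if its tree-unfolding satisfies the global trace condition. -/
def IsProof (P : PreProof B Φ) : Prop := P.unfolding.GlobalTraceCondition

def CutFree (P : PreProof B Φ) : Prop := ∀ σ S r, P.tree σ = some (S, some r) → ¬ r.IsCut

theorem position_of_inner (P : PreProof B Φ) (σ : List ℕ) (h : P.tree.IsInner σ) :
    P.position σ = some σ := by
  induction σ using List.reverseRecOn with
  | nil =>
    obtain ⟨S, r, h⟩ := h
    simp [position, resolve, h]
  | append_singleton σ n ih =>
    have hdom : σ ++ [n] ∈ P.tree.dom := by
      obtain ⟨S, r, h⟩ := h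
      simp [LTree.dom, h]
    have hσ : σ ∈ P.tree.dom := P.isDerivationTree.prefix_closed _ _ hdom
    have hin : P.tree.IsInner σ := by
      obtain ⟨⟨S, o⟩, ho⟩ := Option.isSome_iff_exists.1 hσ
      cases o with
      | some r => exact ⟨S, r, ho⟩
      | none =>
        exact absurd (P.isDerivationTree.sibling_closed σ n 0 hdom (Nat.zero_le _))
          (P.isDerivationTree.bud σ S ho)
    have := ih hin
    obtain ⟨S, r, h⟩ := h
    simp only [position] at this
    rw [position, List.foldl_append, this]
    simp [resolve, h]

theorem position_of_bud (P : PreProof B Φ) (σ : List ℕ) (h : P.tree.IsBud σ) :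
    P.position σ = some (P.companion σ) := by
  rcases List.eq_nil_or_concat σ with rfl | ⟨σ, n, rfl⟩
  · obtain ⟨S, h⟩ := h
    simp [position, resolve, h]
  · rw [List.concat_eq_append] at *
    have hdom : σ ++ [n] ∈ P.tree.dom := by
      obtain ⟨S, h⟩ := h
      simp [LTree.dom, h]
    have hσ : σ ∈ P.tree.dom := P.isDerivationTree.prefix_closed _ _ hdom
    have hin : P.tree.IsInner σ := by
      obtain ⟨⟨S, o⟩, ho⟩ := Option.isSome_iff_exists.1 hσ
      cases o with
      | some r => exact ⟨S, r, ho⟩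
      | none =>
        exact absurd (P.isDerivationTree.sibling_closed σ n 0 hdom (Nat.zero_le _))
          (P.isDerivationTree.bud σ S ho)
    have := P.position_of_inner σ hin
    obtain ⟨S, h⟩ := h
    simp only [position] at this
    rw [position, List.foldl_append, this]
    simp [resolve, h]

/-- First defining equation of the tree-unfolding: it agrees with the tree at inner nodes. -/
theorem unfolding_of_inner (P : PreProof B Φ) (σ : List ℕ) (h : P.tree.IsInner σ) :
    P.unfolding σ = P.tree σ := by
  simp [unfolding, P.position_of_inner σ h]

/-- Second defining equation of the tree-unfolding: below a bud it continues as below the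
companion. -/
theorem unfolding_of_bud (P : PreProof B Φ) (σ₁ σ₂ : List ℕ) (h : P.tree.IsBud σ₁) :
    P.unfolding (σ₁ ++ σ₂) = P.unfolding (P.companion σ₁ ++ σ₂) := by
  have h₁ := P.position_of_bud σ₁ h
  have h₂ := P.position_of_inner _ (P.companion_spec σ₁ h).1
  simp only [position] at h₁ h₂
  simp [unfolding, position, List.foldl_append, h₁, h₂]

end PreProof

/-- Provability of a sequent in the cyclic system. -/
def Provable {B : BaseLanguage.{u, v, w}} (Φ : IndDefSet B) (S : Sequent B) : Prop :=
  ∃ P : PreProof B Φ, P.tree.sequentAt [] = some S ∧ P.IsProof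

/-- Cut-free provability of a sequent in the cyclic system. -/
def CutFreeProvable {B : BaseLanguage.{u, v, w}} (Φ : IndDefSet B) (S : Sequent B) : Prop :=
  ∃ P : PreProof B Φ, P.tree.sequentAt [] = some S ∧ P.IsProof ∧ P.CutFree

section Counterexample

variable {B : BaseLanguage.{u, v, w}}

/-- The atomic formula `P(t)` for a unary inductive predicate symbol `P`. -/
def unaryAtom (P : B.Ind 1) (t : Tm B) : IndAtom B := ⟨1, P, ![t]⟩

/-- The constant `c` as a term. -/
def constTm (c : B.Functions 0) : Tm B := Language.Constants.term c

/-- The term `f t`. -/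
def appTm (f : B.Functions 1) (t : Tm B) : Tm B := f.apply₁ t

/-- The two productions for `TeF`: one has no assumption and the conclusion `TeF(e)`, the other
has the assumption `TeF(next x)` and the conclusion `TeF(x)`. -/
def teFProductions (TeF : B.Ind 1) (e : B.Functions 0) (next : B.Functions 1) (x : ℕ) :
    Set (Production B) :=
  {⟨[], [], unaryAtom TeF (constTm e)⟩,
   ⟨[], [unaryAtom TeF (appTm next (Language.Term.var x))], unaryAtom TeF (Language.Term.var x)⟩}

/-- The two productions for `FsT`: one has no assumption and the conclusion `FsT(s)`, the other
has the assumption `FsT(x)` and the conclusion `FsT(next x)`. -/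
def fsTProductions (FsT : B.Ind 1) (s : B.Functions 0) (next : B.Functions 1) (x : ℕ) :
    Set (Production B) :=
  {⟨[], [], unaryAtom FsT (constTm s)⟩,
   ⟨[], [unaryAtom FsT (Language.Term.var x)], unaryAtom FsT (appTm next (Language.Term.var x))⟩}

/-- The sequent `TeF(s) ⊢ FsT(e)`. -/
noncomputable def counterSequent (TeF FsT : B.Ind 1) (s e : B.Functions 0) : Sequent B :=
  ⟨{Formula.ind (unaryAtom TeF (constTm s))}, {Formula.ind (unaryAtom FsT (constTm e))}⟩

end Counterexample

end CyclicBase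

/-! Provability: cut in `FsT(s)`, which is a production, and generalise `s` to a variable `x`. The
sequent `TeF(x), FsT(x) ⊢ FsT(e)` loops. A case distinction on `TeF(x)` gives either `x = e`, which
is an axiom up to rewriting, or `x = y` with `TeF(next y)`. In the second case, rewriting and a cut
on `FsT(next y)` lead back to the same sequent with `x := next y`. The `TeF` atom progresses once
per round.

Cut-free unprovability: without cut, searching backwards from the root only ever meets equations and
`TeF` atoms on the left and `FsT` atoms on the right. Hence it suffices to refute such sequents in a
structure of two disjoint copies of the integers, with `s` and `e` the origins of different copies
and `next` the successor. `FsT` is refuted on the chain of `e`. `TeF` holds on the chain of `s` and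
at the nonpositive elements of the chain of `e`. A refutation passes from the conclusion of a rule
to some premise, and along a trace the value of the formula goes up by one at each progress point
(`Refutes.exists_premise`).

On the chain of `e` this climb is bounded by 0. On the chain of `s` it must be bounded by other
means. After each step, every variable that the equations on the left do not determine is moved to
the chain of `e`, far below its origin (`Refutes.exists_rigid`). Values remaining on the chain of
`s` are then determined by the sequent alone, and a finite pre-proof has only finitely many
sequents, so one bound serves all of them (`exists_bound_of_rigid`). A trace leaves the chain of `s`
at most once and never returns, so it progresses only finitely often (`not_frequently_increasing`).
The path built from the refuted premises therefore violates the global trace condition. -/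

namespace CyclicBase

/-! ### The two-chain structure and refutation of sequents -/

section Countermodel

variable {B : BaseLanguage.{u, v, w}}

/-- Two disjoint chains of integers: one through `s` (marked `true`), one through `e`. -/
abbrev TwoChain := Bool × ℤ

open Classical in
/-- Interpretation of the function symbols in the two chains: every symbol other than `s` and
`next` is constant with value the origin of the `false` chain. -/
noncomputable def chainFun (s : B.Functions 0) (next : B.Functions 1) :
    ∀ {n : ℕ}, B.Functions n → (Fin n → TwoChain) → TwoChain
  | 0, f, _ => if f = s then (true, 0) else (false, 0)
  | 1, f, v => if f = next then ((v 0).1, (v 0).2 + 1) else (false, 0)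
  | _ + 2, _, _ => (false, 0)

/-- The value of a term in the two chains. -/
noncomputable def eval (s : B.Functions 0) (next : B.Functions 1) (ρ : ℕ → TwoChain) :
    Tm B → TwoChain
  | .var x => ρ x
  | .func f ts => chainFun s next f fun i => eval s next ρ (ts i)

variable (s e : B.Functions 0) (next : B.Functions 1) (ρ : ℕ → TwoChain)

@[simp]
theorem eval_var (x : ℕ) : eval s next ρ (.var x) = ρ x := by simp [eval]

@[simp]
theorem eval_constTm_self : eval s next ρ (constTm s) = (true, 0) := by
  simp [constTm, Language.Constants.term, eval, chainFun]

theorem eval_constTm_of_ne (h : s ≠ e) : eval s next ρ (constTm e) = (false, 0) := by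
  simp [constTm, Language.Constants.term, eval, chainFun, h.symm]

@[simp]
theorem eval_appTm (t : Tm B) : eval s next ρ (appTm next t) =
    ((eval s next ρ t).1, (eval s next ρ t).2 + 1) := by
  simp [appTm, Language.Functions.apply₁, eval, chainFun]

theorem eval_subst (θ : Substitution B) (t : Tm B) :
    eval s next ρ (t.subst θ) = eval s next (fun x => eval s next ρ (θ x)) t := by
  induction t with
  | var x => simp [Language.Term.subst]
  | func f ts ih => simp [Language.Term.subst, eval, ih]

theorem eval_congr {ρ ρ' : ℕ → TwoChain} (t : Tm B) (h : ∀ x ∈ t.varFinset, ρ x = ρ' x) :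
    eval s next ρ t = eval s next ρ' t := by
  induction t with
  | var x => simpa [Language.Term.varFinset] using h
  | func f ts ih =>
    simp only [eval]
    congr 1
    funext i
    refine ih i fun x hx => h x ?_
    simp only [Language.Term.varFinset, Finset.mem_biUnion, Finset.mem_univ, true_and]
    exact ⟨i, hx⟩

/-- The value of the first argument of an atomic formula. -/
noncomputable def atomValue {R : ℕ → Type*} : Atom B R → TwoChain
  | ⟨0, _, _⟩ => (false, 0)
  | ⟨_ + 1, _, a⟩ => eval s next ρ (a 0)

@[simp]
theorem atomValue_unaryAtom (P : B.Ind 1) (t : Tm B) :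
    atomValue s next ρ (unaryAtom P t) = eval s next ρ t := rfl

theorem atomValue_subst {R : ℕ → Type*} (θ : Substitution B) (A : Atom B R) :
    atomValue s next ρ (A.subst θ) = atomValue s next (fun x => eval s next ρ (θ x)) A := by
  obtain ⟨n, P, a⟩ := A
  cases n with
  | zero => rfl
  | succ n => exact eval_subst s next ρ θ (a 0)

theorem atomValue_congr {R : ℕ → Type*} {ρ ρ' : ℕ → TwoChain} (A : Atom B R)
    (h : ∀ x ∈ A.vars, ρ x = ρ' x) : atomValue s next ρ A = atomValue s next ρ' A := by
  obtain ⟨n, P, a⟩ := A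
  cases n with
  | zero => rfl
  | succ n =>
    refine eval_congr s next (a 0) fun x hx => h x ?_
    simp only [Atom.vars, Finset.mem_biUnion, Finset.mem_univ, true_and]
    exact ⟨0, hx⟩

/-- The value of the first argument of an inductive atomic formula. -/
noncomputable def formulaValue : Formula B → TwoChain
  | .ind A => atomValue s next ρ A
  | _ => (false, 0)

theorem formulaValue_subst (θ : Substitution B) (φ : Formula B) :
    formulaValue s next ρ (φ.subst θ) =
      formulaValue s next (fun x => eval s next ρ (θ x)) φ := by
  cases φ <;> simp [formulaValue, Formula.subst, atomValue_subst]

theorem formulaValue_congr {ρ ρ' : ℕ → TwoChain} (φ : Formula B)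
    (h : ∀ x ∈ φ.vars, ρ x = ρ' x) : formulaValue s next ρ φ = formulaValue s next ρ' φ := by
  cases φ with
  | ind A => exact atomValue_congr s next A h
  | _ => rfl

variable (TeF FsT : B.Ind 1)

/-- Truth of the formulas that occur in antecedents: equations, and `TeF` atoms, where `TeF` holds
on the chain of `s` and on the elements from which `e` can be reached. -/
def AnteHolds : Formula B → Prop
  | .eq t u => eval s next ρ t = eval s next ρ u
  | .ord _ => False
  | .ind A => A.symbol = ⟨1, TeF⟩ ∧
      ((atomValue s next ρ A).1 = false → (atomValue s next ρ A).2 ≤ 0)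

/-- Falsity of the formulas that occur in succedents: `FsT` fails on the chain of `e`. -/
def SuccFails : Formula B → Prop
  | .ind A => A.symbol = ⟨1, FsT⟩ ∧ (atomValue s next ρ A).1 = false
  | _ => False

variable {s e next ρ TeF FsT}

theorem anteHolds_subst {θ : Substitution B} {φ : Formula B} :
    AnteHolds s next ρ TeF (φ.subst θ) ↔
      AnteHolds s next (fun x => eval s next ρ (θ x)) TeF φ := by
  cases φ with
  | eq t u => simp only [AnteHolds, Formula.subst, eval_subst]
  | ord A => rfl
  | ind A =>
    simp only [AnteHolds, Formula.subst, atomValue_subst]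
    rfl

theorem succFails_subst {θ : Substitution B} {φ : Formula B} :
    SuccFails s next ρ FsT (φ.subst θ) ↔
      SuccFails s next (fun x => eval s next ρ (θ x)) FsT φ := by
  cases φ with
  | ind A =>
    simp only [SuccFails, Formula.subst, atomValue_subst]
    rfl
  | _ => rfl

theorem anteHolds_congr {ρ ρ' : ℕ → TwoChain} {φ : Formula B} (h : ∀ x ∈ φ.vars, ρ x = ρ' x)
    (hφ : AnteHolds s next ρ TeF φ) : AnteHolds s next ρ' TeF φ := by
  cases φ with
  | eq t u =>
    simp only [Formula.vars, Finset.mem_union] at h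
    have ht := eval_congr s next t fun x hx => h x (Or.inl hx)
    have hu := eval_congr s next u fun x hx => h x (Or.inr hx)
    simpa only [AnteHolds, ht, hu] using hφ
  | ord A => exact hφ
  | ind A => simpa only [AnteHolds, atomValue_congr s next A h] using hφ

theorem succFails_congr {ρ ρ' : ℕ → TwoChain} {φ : Formula B} (h : ∀ x ∈ φ.vars, ρ x = ρ' x)
    (hφ : SuccFails s next ρ FsT φ) : SuccFails s next ρ' FsT φ := by
  cases φ with
  | ind A => simpa only [SuccFails, atomValue_congr s next A h] using hφ
  | _ => exact hφ

variable (s next ρ TeF FsT) in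
/-- The valuation `ρ` refutes the sequent `S`. -/
def Refutes (S : Sequent B) : Prop :=
  (∀ φ ∈ S.ante, AnteHolds s next ρ TeF φ) ∧ ∀ φ ∈ S.succ, SuccFails s next ρ FsT φ

variable (s next) in
/-- The valuations that satisfy the equations in the antecedent of `S`. -/
def eqSolutions (S : Sequent B) : Set (ℕ → TwoChain) :=
  {ρ | ∀ t u, Formula.eq t u ∈ S.ante → eval s next ρ t = eval s next ρ u}

variable (s next ρ) in
/-- Every formula of the antecedent of `S` with a value in the chain of `s` has the same value under
all solutions of the equations in the antecedent. -/
def Rigid (S : Sequent B) : Prop :=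
  ∀ φ ∈ S.ante, (formulaValue s next ρ φ).1 = true →
    ∀ ρ' ∈ eqSolutions s next S, formulaValue s next ρ' φ = formulaValue s next ρ φ

theorem Refutes.mem_eqSolutions {S : Sequent B} (h : Refutes s next ρ TeF FsT S) :
    ρ ∈ eqSolutions s next S := fun _ _ hφ => h.1 _ hφ

/-! ### Rigid refutations: detaching the variables that the equations leave free -/

/-- Move an element of the chain of `s` to the chain of `e`. -/
def detach (K : ℤ) (a : TwoChain) : TwoChain := if a.1 then (false, a.2 - K) else a

open Classical in
/-- Detach the variables whose value is not the same for all valuations in `E`. -/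
noncomputable def detachValuation (E : Set (ℕ → TwoChain)) (K : ℤ) (ρ : ℕ → TwoChain) :
    ℕ → TwoChain := fun x => if ∀ ρ' ∈ E, ρ' x = ρ x then ρ x else detach K (ρ x)

-- The value of a term depends on at most one variable, and only through the injective successor,
-- since all other function symbols are constant. So a term is determined by `E` exactly when its
-- variable is, and the shift by `K` commutes with the successor.
open Classical in
theorem eval_detachValuation (E : Set (ℕ → TwoChain)) (K : ℤ) (t : Tm B) :
    eval s next (detachValuation E K ρ) t =
      if ∀ ρ' ∈ E, eval s next ρ' t = eval s next ρ t then eval s next ρ t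
      else detach K (eval s next ρ t) := by
  induction t with
  | var x => simp [detachValuation]
  | @func n f ts ih =>
    match n, f with
    | 0, f => simp [eval, chainFun]
    | 1, f =>
      by_cases hf : f = next
      · simp only [eval, chainFun, hf, if_true, ih, Prod.mk.injEq, add_left_inj, ← Prod.ext_iff]
        split_ifs with h
        · rfl
        · simp only [detach]
          split_ifs <;> simp [sub_add_eq_add_sub]
      · simp [eval, chainFun, hf]
    | _ + 2, f => simp [eval, chainFun]

open Classical in
theorem formulaValue_detachValuation (E : Set (ℕ → TwoChain)) (K : ℤ) (φ : Formula B) :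
    formulaValue s next (detachValuation E K ρ) φ =
      if ∀ ρ' ∈ E, formulaValue s next ρ' φ = formulaValue s next ρ φ then formulaValue s next ρ φ
      else detach K (formulaValue s next ρ φ) := by
  match φ with
  | .eq _ _ | .ord _ | .ind ⟨0, _, _⟩ => simp [formulaValue, atomValue]
  | .ind ⟨_ + 1, _, a⟩ => exact eval_detachValuation E K (a 0)

theorem exists_formulaValue_le (ρ : ℕ → TwoChain) (Γ : Finset (Formula B)) :
    ∃ K : ℤ, ∀ φ ∈ Γ, (formulaValue s next ρ φ).2 ≤ K := by
  obtain ⟨K, hK⟩ := (Γ.image fun φ => (formulaValue s next ρ φ).2).bddAbove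
  exact ⟨K, fun φ hφ => hK (Finset.mem_coe.2 (Finset.mem_image_of_mem _ hφ))⟩

/-- A refuting valuation can be made rigid. -/
theorem Refutes.exists_rigid {S : Sequent B} (h : Refutes s next ρ TeF FsT S) :
    ∃ ρ', Refutes s next ρ' TeF FsT S ∧ Rigid s next ρ' S ∧
      ∀ φ : Formula B, formulaValue s next ρ' φ = formulaValue s next ρ φ ∨
        ((formulaValue s next ρ φ).1 = true ∧ (formulaValue s next ρ' φ).1 = false) := by
  classical
  -- Shifting by an upper bound of the antecedent values puts every detached `TeF` argument at or
  -- below the origin of the chain of `e`, where `TeF` holds.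
  obtain ⟨K, hK⟩ := exists_formulaValue_le (s := s) (next := next) ρ S.ante
  have hval := formulaValue_detachValuation (s := s) (next := next) (ρ := ρ)
    (eqSolutions s next S) K
  refine ⟨detachValuation (eqSolutions s next S) K ρ, ⟨fun φ hφ => ?_, fun φ hφ => ?_⟩,
    fun φ hφ htrue ρ' hρ' => ?_, fun φ => ?_⟩
  · have h1 := h.1 φ hφ
    cases φ with
    | eq t u =>
      -- The two sides of an equation agree under every solution, so both are detached or neither
      -- is; the equation survives.
      have hiff : (∀ ρ' ∈ eqSolutions s next S, eval s next ρ' t = eval s next ρ t) ↔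
          ∀ ρ' ∈ eqSolutions s next S, eval s next ρ' u = eval s next ρ u :=
        forall₂_congr fun ρ' hρ' => by rw [hρ' t u hφ, show eval s next ρ t = _ from h1]
      simp only [AnteHolds, eval_detachValuation, hiff]
      rw [show eval s next ρ t = _ from h1]
    | ord A => exact h1
    | ind A =>
      refine ⟨h1.1, fun hfalse => ?_⟩
      have hA : atomValue s next _ A = _ := hval (.ind A)
      have hKA := hK _ hφ
      rw [hA] at hfalse ⊢
      by_cases hc : ∀ ρ' ∈ eqSolutions s next S,
        formulaValue s next ρ' (.ind A) = formulaValue s next ρ (.ind A)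
      · rw [if_pos hc] at hfalse ⊢
        exact h1.2 hfalse
      · rw [if_neg hc] at hfalse ⊢
        unfold detach at hfalse ⊢
        by_cases hc' : (formulaValue s next ρ (.ind A)).1 = true
        · simpa [if_pos hc'] using hKA
        · rw [if_neg hc'] at hfalse ⊢
          exact h1.2 hfalse
  -- Succedent values already lie on the chain of `e`, where detaching does nothing.
  · have h1 := h.2 φ hφ
    cases φ with
    | ind A =>
      refine ⟨h1.1, ?_⟩
      have hA := hval (.ind A)
      simp only [formulaValue] at hA
      rw [hA]
      simp [detach, h1.2]
    | _ => exact h1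
  -- A value still on the chain of `s` was not detached, hence is constant on the solutions.
  · rw [hval] at htrue ⊢
    split_ifs at htrue ⊢ with hc
    · exact hc ρ' hρ'
    · simp only [detach] at htrue
      split_ifs at htrue
      contradiction
  · rw [hval]
    split_ifs
    · exact Or.inl rfl
    · simp only [detach]
      split_ifs with hc
      · exact Or.inr ⟨hc, rfl⟩
      · exact Or.inl rfl

end Countermodel

/-! ### Refutations pass backwards through the cut-free rules -/

section Countermodel

variable {B : BaseLanguage.{u, v, w}}

variable {s e : B.Functions 0} {next : B.Functions 1} {ρ : ℕ → TwoChain} {TeF FsT : B.Ind 1}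

theorem Atom.eq_unaryAtom_of_symbol {A : IndAtom B} {P : B.Ind 1} (h : A.symbol = ⟨1, P⟩) :
    ∃ t, A = unaryAtom P t := by
  obtain ⟨n, Q, a⟩ := A
  cases h
  refine ⟨a 0, ?_⟩
  simp only [unaryAtom]
  congr
  funext i
  rw [Subsingleton.elim i 0]
  rfl

theorem unaryAtom_subst (P : B.Ind 1) (t : Tm B) (θ : Substitution B) :
    (unaryAtom P t).subst θ = unaryAtom P (t.subst θ) := by
  simp only [unaryAtom, Atom.subst]
  congr
  funext i
  rw [Subsingleton.elim i 0]
  rfl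

theorem unaryAtom_argList (P : B.Ind 1) (t : Tm B) : (unaryAtom P t).argList = [t] := by
  simp [unaryAtom, Atom.argList]

theorem unaryAtom_vars (P : B.Ind 1) (t : Tm B) : (unaryAtom P t).vars = t.varFinset := by
  ext z
  simp only [unaryAtom, Atom.vars, Finset.mem_biUnion]
  exact ⟨fun ⟨i, hi⟩ => by simpa using hi.2, fun h => ⟨0, Finset.mem_univ _, h⟩⟩

theorem constTm_subst (c : B.Functions 0) (θ : Substitution B) :
    (constTm c).subst θ = constTm c := by
  simp [constTm, Language.Constants.term, Language.Term.subst]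
  exact Subsingleton.elim _ _

theorem appTm_subst (f : B.Functions 1) (t : Tm B) (θ : Substitution B) :
    (appTm f t).subst θ = appTm f (t.subst θ) := by
  simp only [appTm, Language.Functions.apply₁, Language.Term.subst]
  congr
  funext i
  rw [Subsingleton.elim i 0]
  rfl

theorem constTm_varFinset (c : B.Functions 0) :
    (constTm c : Tm B).varFinset = ∅ := by
  simp [constTm, Language.Constants.term]

theorem appTm_varFinset (f : B.Functions 1) (t : Tm B) :
    (appTm f t).varFinset = t.varFinset := by
  ext z
  simp [appTm, Language.Functions.apply₁]

theorem constTm_injective : Function.Injective (constTm : B.Functions 0 → Tm B) := by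
  intro c d h
  simp only [constTm, Language.Constants.term, Language.Term.func.injEq, heq_eq_eq,
    true_and] at h
  exact h.1

theorem unaryAtom_injective (P : B.Ind 1) : Function.Injective (unaryAtom P) := by
  intro t u h
  simpa [unaryAtom_argList] using congrArg Atom.argList h

variable {Φ : IndDefSet B} {x y : ℕ}

/-- Needed for the axiom rule: a formula on both sides of a refuted sequent would be a `TeF` and an
`FsT` atom at once. If the symbols coincided, the production `TeF(e)` would have to be one of the
`FsT` productions, but these conclude with `s ≠ e` or have an assumption. -/
theorem ne_of_productionsFor (hse : s ≠ e)
    (hTeF : productionsFor Φ ⟨1, TeF⟩ = teFProductions TeF e next x)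
    (hFsT : productionsFor Φ ⟨1, FsT⟩ = fsTProductions FsT s next y) : TeF ≠ FsT := by
  rintro rfl
  rw [hTeF] at hFsT
  have h : (⟨[], [], unaryAtom TeF (constTm e)⟩ : Production B) ∈
      fsTProductions TeF s next y := hFsT ▸ Set.mem_insert _ _
  rcases h with h | h
  · exact hse (constTm_injective (unaryAtom_injective TeF (congrArg Production.concl h))).symm
  · simpa using congrArg Production.indAsm h

variable (s next) in
/-- How the values of trace formulas develop from the conclusion to the `n`-th premise of `r`. -/
def ValuesAdvance (r : RuleApp B) (n : ℕ) (ρ ρ' : ℕ → TwoChain) : Prop :=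
  ∀ τ ∈ r.conclusion.ante, ∀ τ', r.TraceStep n τ τ' →
    (formulaValue s next ρ' τ').1 = (formulaValue s next ρ τ).1 ∧
    (formulaValue s next ρ τ).2 ≤ (formulaValue s next ρ' τ').2 ∧
    (r.Progress n τ τ' → (formulaValue s next ρ τ).2 < (formulaValue s next ρ' τ').2)

/-- The conclusion is an `FsT` atom on the chain of `e`, so the production `FsT(s)` is excluded; in
the other one, removing `next` stays on the same chain. -/
theorem refutes_premise_indR (hFsT : productionsFor Φ ⟨1, FsT⟩ = fsTProductions FsT s next y)
    {Γ Δ : Finset (Formula B)} {p : Production B} {θ : Substitution B} (hp : p ∈ Φ)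
    (h : Refutes s next ρ TeF FsT (RuleApp.indR Γ Δ p θ).conclusion) :
    ∃ S', (RuleApp.indR Γ Δ p θ).premises[0]? = some S' ∧ Refutes s next ρ TeF FsT S' := by
  have hsucc := h.2 (.ind (p.concl.subst θ)) (Finset.mem_insert_self _ _)
  have hmem : p ∈ fsTProductions FsT s next y := by
    rw [← hFsT]
    exact ⟨hp, hsucc.1⟩
  rcases hmem with rfl | rfl
  · have h2 := hsucc.2
    simp [unaryAtom_subst, constTm_subst] at h2
  · refine ⟨⟨Γ, insert (.ind (unaryAtom FsT (θ y))) Δ⟩, ?_, h.1, fun φ hφ => ?_⟩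
    · simp [RuleApp.premises, Production.asm, unaryAtom_subst, Language.Term.subst]
    · rcases Finset.mem_insert.1 hφ with rfl | hφ
      · refine ⟨rfl, ?_⟩
        have h2 := hsucc.2
        simpa [unaryAtom_subst, appTm_subst, Language.Term.subst] using h2
      · exact h.2 _ (Finset.mem_insert_of_mem hφ)

/-- The refuting valuation selects the premise. At the value of `e` the base premise holds and has
no descendant. Everywhere else `TeF` is still true one step further on, and the descendant takes
that larger value. -/
theorem refutes_premise_case (hse : s ≠ e)
    (hTeF : productionsFor Φ ⟨1, TeF⟩ = teFProductions TeF e next x)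
    {Γ Δ : Finset (Formula B)} {A : IndAtom B} {cs : List (Production B × (ℕ → ℕ))}
    (hr : (RuleApp.case Γ Δ A cs).Valid Φ)
    (h : Refutes s next ρ TeF FsT (RuleApp.case Γ Δ A cs).conclusion) :
    ∃ n S' ρ', (RuleApp.case Γ Δ A cs).premises[n]? = some S' ∧ Refutes s next ρ' TeF FsT S' ∧
      ValuesAdvance s next (.case Γ Δ A cs) n ρ ρ' := by
  have hA := h.1 (.ind A) (Finset.mem_insert_self _ _)
  obtain ⟨t, rfl⟩ := Atom.eq_unaryAtom_of_symbol hA.1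
  obtain ⟨-, hcs, hfresh⟩ := hr
  have hcs' : ∀ p, p ∈ teFProductions TeF e next x → ∃ c ∈ cs, c.1 = p := fun p hp => by
    rw [← hTeF] at hp
    exact List.mem_map.1 ((hcs p).2 hp)
  have hant := hA.2
  rw [atomValue_unaryAtom] at hant
  by_cases hv : eval s next ρ t = (false, 0)
  · obtain ⟨⟨p, f⟩, hc, rfl⟩ := hcs' _ (Set.mem_insert _ _)
    obtain ⟨n, hn⟩ := List.mem_iff_getElem?.1 hc
    refine ⟨n, ⟨Γ ∪ Production.caseFormulas _ f _, Δ⟩, ρ,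
      by simp only [RuleApp.premises, List.getElem?_map, hn]; rfl,
      ⟨fun φ hφ => ?_, h.2⟩, fun τ _ τ' hstep => ?_⟩
    · rcases Finset.mem_union.1 hφ with hφ | hφ
      · exact h.1 φ (Finset.mem_insert_of_mem hφ)
      · simp only [Production.caseFormulas, Production.asm, unaryAtom_subst, unaryAtom_argList,
          constTm_subst] at hφ
        simp at hφ
        subst hφ
        simp only [AnteHolds, hv, eval_constTm_of_ne s e next ρ hse]
    · have hprog : ¬ (RuleApp.case Γ Δ (unaryAtom TeF t) cs).Progress n τ τ' := by
        rintro ⟨-, c, hc', A', hA', -⟩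
        rw [hn] at hc'
        cases hc'
        simp at hA'
      rcases hstep with hstep | rfl
      · exact absurd hstep hprog
      · exact ⟨rfl, le_rfl, fun h => absurd h hprog⟩
  · obtain ⟨⟨p, f⟩, hc, rfl⟩ := hcs' _ (Set.mem_insert_of_mem _ rfl)
    obtain ⟨n, hn⟩ := List.mem_iff_getElem?.1 hc
    have hnot : f x ∉ varsSet (insert (.ind (unaryAtom TeF t)) (Γ ∪ Δ)) := by
      refine (hfresh _ hc).2 x (Or.inr (Or.inr ?_))
      simp [unaryAtom_vars]
    have hagree : ∀ φ ∈ insert (.ind (unaryAtom TeF t)) (Γ ∪ Δ), ∀ z ∈ Formula.vars φ,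
        ρ z = Function.update ρ (f x) (eval s next ρ t) z := fun φ hφ z hz => by
      rw [Function.update_of_ne]
      rintro rfl
      exact hnot (Finset.mem_biUnion.2 ⟨φ, hφ, hz⟩)
    have ht : eval s next (Function.update ρ (f x) (eval s next ρ t)) t = eval s next ρ t :=
      (eval_congr s next t fun z hz => hagree _ (Finset.mem_insert_self _ _) z
        (by simpa [Formula.vars, unaryAtom_vars] using hz)).symm
    -- The fresh variable receives the value of `t`, which makes the new equation true and, by
    -- freshness, changes no old formula.
    refine ⟨n, ⟨Γ ∪ Production.caseFormulas _ f _, Δ⟩,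
      Function.update ρ (f x) (eval s next ρ t),
      by simp only [RuleApp.premises, List.getElem?_map, hn]; rfl,
      ⟨fun φ hφ => ?_, fun φ hφ => ?_⟩, fun τ hτ τ' hstep => ?_⟩
    · rcases Finset.mem_union.1 hφ with hφ | hφ
      · exact anteHolds_congr (hagree φ (by simp [hφ])) (h.1 φ (Finset.mem_insert_of_mem hφ))
      · simp only [Production.caseFormulas, Production.asm, unaryAtom_subst, unaryAtom_argList,
          Language.Term.subst] at hφ
        simp [unaryAtom_subst, appTm_subst, Language.Term.subst] at hφ
        rcases hφ with rfl | rfl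
        · simp [AnteHolds, ht]
        · refine ⟨rfl, ?_⟩
          simp only [atomValue_unaryAtom, eval_appTm, eval_var, Function.update_self]
          intro hfalse
          have := hant hfalse
          -- A nonpositive integer other than 0 is at most -1, so its successor is still
          -- nonpositive.
          have : (eval s next ρ t).2 ≠ 0 := fun h0 => hv (Prod.ext hfalse h0)
          lia
    · exact succFails_congr (hagree φ (by simp [show φ ∈ Δ from hφ])) (h.2 φ hφ)
    · have hprog : (RuleApp.case Γ Δ (unaryAtom TeF t) cs).Progress n τ τ' →
          formulaValue s next (Function.update ρ (f x) (eval s next ρ t)) τ' =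
            ((formulaValue s next ρ τ).1, (formulaValue s next ρ τ).2 + 1) := by
        rintro ⟨rfl, c, hc', A', hA', rfl⟩
        rw [hn] at hc'
        cases hc'
        simp at hA'
        subst hA'
        simp [formulaValue, unaryAtom_subst, appTm_subst, Language.Term.subst]
      rcases hstep with hstep | rfl
      · simp [hprog hstep]
      · have hval : formulaValue s next (Function.update ρ (f x) (eval s next ρ t)) τ' =
            formulaValue s next ρ τ' := by
          refine (formulaValue_congr s next τ' (hagree τ' ?_)).symm
          rcases Finset.mem_insert.1 hτ with rfl | hτ
          · exact Finset.mem_insert_self _ _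
          · simp [hτ]
        refine ⟨by rw [hval], by rw [hval], fun hp => ?_⟩
        simp [hprog hp]

/-- A refutation of the conclusion of a rule other than cut yields one of a premise. -/
theorem Refutes.exists_premise (hse : s ≠ e)
    (hTeF : productionsFor Φ ⟨1, TeF⟩ = teFProductions TeF e next x)
    (hFsT : productionsFor Φ ⟨1, FsT⟩ = fsTProductions FsT s next y)
    {r : RuleApp B} (hr : r.Valid Φ) (hcut : ¬ r.IsCut)
    (h : Refutes s next ρ TeF FsT r.conclusion) :
    ∃ n S' ρ', r.premises[n]? = some S' ∧ Refutes s next ρ' TeF FsT S' ∧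
      ValuesAdvance s next r n ρ ρ' := by
  cases r with
  | ax Γ Δ =>
    obtain ⟨φ, hφ⟩ := hr
    obtain ⟨hΓ, hΔ⟩ := Finset.mem_inter.1 hφ
    have h1 := h.1 φ hΓ
    have h2 := h.2 φ hΔ
    cases φ with
    | ind A =>
      have := h1.1.symm.trans h2.1
      simp at this
      exact absurd this (ne_of_productionsFor hse hTeF hFsT)
    | _ => exact h2.elim
  | weak Γ' Δ' Γ Δ =>
    refine ⟨0, _, ρ, rfl, ⟨fun φ hφ => h.1 φ (hr.1 hφ), fun φ hφ => h.2 φ (hr.2 hφ)⟩, ?_⟩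
    rintro τ - τ' rfl
    exact ⟨rfl, le_rfl, False.elim⟩
  | cut Γ Δ φ => exact absurd trivial hcut
  | subst Γ Δ θ =>
    refine ⟨0, _, fun z => eval s next ρ (θ z), rfl,
      ⟨fun φ hφ => anteHolds_subst.1 (h.1 _ (Finset.mem_image_of_mem _ hφ)),
       fun φ hφ => succFails_subst.1 (h.2 _ (Finset.mem_image_of_mem _ hφ))⟩, ?_⟩
    rintro τ - τ' rfl
    rw [formulaValue_subst]
    exact ⟨rfl, le_rfl, False.elim⟩
  | eqLa Γ Δ a b t u =>
    have htu : eval s next ρ t = eval s next ρ u := h.1 _ (Finset.mem_insert_self _ _)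
    -- As `t` and `u` have equal values, both substitutions induce the same valuation; the rule
    -- changes no truth value and no trace value.
    have hswap : (fun z => eval s next ρ (subst₂ a b t u z)) =
        fun z => eval s next ρ (subst₂ a b u t z) := by
      funext z
      simp only [subst₂]
      split_ifs <;> simp [htu]
    refine ⟨0, _, ρ, rfl, ⟨fun φ hφ => ?_, fun φ hφ => ?_⟩, ?_⟩
    · rcases Finset.mem_insert.1 hφ with rfl | hφ
      · exact htu
      · obtain ⟨ψ, hψ, rfl⟩ := Finset.mem_image.1 hφ
        rw [anteHolds_subst, ← hswap, ← anteHolds_subst]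
        exact h.1 _ (Finset.mem_insert_of_mem (Finset.mem_image_of_mem _ hψ))
    · obtain ⟨ψ, hψ, rfl⟩ := Finset.mem_image.1 hφ
      rw [succFails_subst, ← hswap, ← succFails_subst]
      exact h.2 _ (Finset.mem_image_of_mem _ hψ)
    · rintro τ - τ' ⟨φ, rfl, rfl⟩
      rw [formulaValue_subst, formulaValue_subst, hswap]
      exact ⟨rfl, le_rfl, False.elim⟩
  | eqR Γ Δ t => exact (h.2 (.eq t t) (Finset.mem_insert_self _ _)).elim
  | indR Γ Δ p θ =>
    obtain ⟨S', hS', hS'r⟩ := refutes_premise_indR hFsT hr h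
    refine ⟨0, S', ρ, hS', hS'r, ?_⟩
    rintro τ - τ' rfl
    exact ⟨rfl, le_rfl, False.elim⟩
  | case Γ Δ A cs => exact refutes_premise_case hse hTeF hr h

end Countermodel

/-! ### Positions in the tree-unfolding -/

namespace PreProof

variable {B : BaseLanguage.{u, v, w}} {Φ : IndDefSet B} (P : PreProof B Φ)

theorem position_append_singleton (σ : List ℕ) (n : ℕ) :
    P.position (σ ++ [n]) = (P.position σ).bind fun μ => P.resolve (μ ++ [n]) := by
  simp [position, List.foldl_append]

theorem exists_resolve {ν : List ℕ} {S : Sequent B} (h : P.tree.sequentAt ν = some S) :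
    ∃ μ r, P.resolve ν = some μ ∧ P.tree μ = some (S, some r) := by
  obtain ⟨⟨S', o⟩, ho, rfl⟩ := Option.map_eq_some_iff.1 h
  cases o with
  | some r => exact ⟨ν, r, by simp [resolve, ho], ho⟩
  | none =>
    obtain ⟨⟨S'', r, hr⟩, h2⟩ := P.companion_spec ν ⟨S', ho⟩
    refine ⟨P.companion ν, r, by simp [resolve, ho], ?_⟩
    simp only [LTree.sequentAt, hr, ho, Option.map_some, Option.some.injEq] at h2
    rw [hr, h2]

end PreProof

/-! ### The refuted path and the failure of the trace condition -/

section Countermodel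

variable {B : BaseLanguage.{u, v, w}}
variable {s e : B.Functions 0} {next : B.Functions 1} {ρ : ℕ → TwoChain} {TeF FsT : B.Ind 1}
variable {Φ : IndDefSet B} {x y : ℕ}

/-- A sequence in the two chains that never returns to the `true` chain, and is monotone and
bounded on each chain, increases only finitely often. -/
theorem not_frequently_increasing (f : ℕ → TwoChain) (Q : ℕ → Prop) (N : ℤ)
    (hchain : ∀ i, (f (i + 1)).1 = true → (f i).1 = true)
    (hle : ∀ i, (f (i + 1)).1 = (f i).1 → (f i).2 ≤ (f (i + 1)).2 ∧
      (Q i → (f i).2 < (f (i + 1)).2))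
    (hN : ∀ i, (f i).2 ≤ N) : ¬ ∀ n, ∃ i ≥ n, Q i := by
  intro hQ
  -- The `true` chain is left at most once, so from some `k` on the sequence stays on a single
  -- chain.
  obtain ⟨k, hk⟩ : ∃ k, ∀ i ≥ k, (f (i + 1)).1 = (f i).1 := by
    by_cases h : ∃ k, (f k).1 = false
    · obtain ⟨k, hk⟩ := h
      have hfalse : ∀ i ≥ k, (f i).1 = false := fun i hi => by
        induction i, hi using Nat.le_induction with
        | base => exact hk
        | succ i _ ih =>
          by_contra hne
          simp [hchain i (by simpa using hne)] at ih
      exact ⟨k, fun i hi => by rw [hfalse i hi, hfalse (i + 1) (by lia)]⟩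
    · push Not at h
      simp only [ne_eq, Bool.not_eq_false] at h
      exact ⟨0, fun i _ => by rw [h, h]⟩
  have hmono : ∀ i ≥ k, ∀ j ≥ i, (f i).2 ≤ (f j).2 := fun i hi j hj => by
    induction j, hj using Nat.le_induction with
    | base => exact le_rfl
    | succ j hj ih => exact ih.trans (hle j (hk j (hi.trans hj))).1
  have hunb : ∀ m : ℕ, ∃ i ≥ k, (f k).2 + m ≤ (f i).2 := fun m => by
    induction m with
    | zero => exact ⟨k, le_rfl, by simp⟩
    | succ m ih =>
      obtain ⟨i, hi, him⟩ := ih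
      obtain ⟨j, hj, hQj⟩ := hQ i
      have h1 := hmono i hi j hj
      have h2 := (hle j (hk j (le_trans hi hj))).2 hQj
      exact ⟨j + 1, by lia, by push_cast; lia⟩
  -- This many increases after `k` carry the value past `N`.
  obtain ⟨i, -, hi⟩ := hunb (N - (f k).2 + 1).toNat
  have := hN i
  have := hN k
  lia

/-- Rigid refutations of a given sequent give bounded values to its antecedent. -/
theorem exists_bound_of_rigid (s : B.Functions 0) (next : B.Functions 1) (TeF FsT : B.Ind 1)
    (S : Sequent B) :
    ∃ N : ℤ, ∀ ρ, Refutes s next ρ TeF FsT S → Rigid s next ρ S →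
      ∀ φ ∈ S.ante, (formulaValue s next ρ φ).2 ≤ N := by
  by_cases h : ∃ ρ₀, Refutes s next ρ₀ TeF FsT S
  · obtain ⟨ρ₀, h₀⟩ := h
    obtain ⟨K, hK⟩ := exists_formulaValue_le (s := s) (next := next) ρ₀ S.ante
    -- One fixed refutation `ρ₀` solves the equations too, so rigid values on the chain of `s` are
    -- its values, bounded by `K`; on the chain of `e`, truth of `TeF` gives the bound 0.
    refine ⟨max 0 K, fun ρ hρ hrigid φ hφ => ?_⟩
    cases hv : (formulaValue s next ρ φ).1 with
    | true =>
      rw [← hrigid φ hφ hv ρ₀ h₀.mem_eqSolutions]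
      exact (hK φ hφ).trans (le_max_right _ _)
    | false =>
      refine le_trans ?_ (le_max_left _ _)
      cases φ with
      | ind A => exact (hρ.1 _ hφ).2 hv
      | _ => exact le_rfl
  · exact ⟨0, fun ρ hρ => absurd ⟨ρ, hρ⟩ h⟩

variable (s next TeF FsT) in
/-- A node of the tree-unfolding with a rigid refutation of its sequent. -/
structure RefutedNode (P : PreProof B Φ) where
  address : List ℕ
  node : List ℕ
  rule : RuleApp B
  valuation : ℕ → TwoChain
  position_eq : P.position address = some node
  tree_eq : P.tree node = some (rule.conclusion, some rule)
  refutes : Refutes s next valuation TeF FsT rule.conclusion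
  rigid : Rigid s next valuation rule.conclusion

/-- A bud carries the sequent of its companion, so the refutation survives the jump; it is then made
rigid. The last clause records the only possible damage to trace values, a move from the chain of
`s` to that of `e`. -/
theorem Refutes.exists_refutedNode {P : PreProof B Φ} {σ ν : List ℕ} {S : Sequent B}
    (h : Refutes s next ρ TeF FsT S) (hσ : P.position σ = P.resolve ν)
    (hν : P.tree.sequentAt ν = some S) :
    ∃ R : RefutedNode s next TeF FsT P, R.address = σ ∧
      ∀ φ : Formula B, formulaValue s next R.valuation φ = formulaValue s next ρ φ ∨
        ((formulaValue s next ρ φ).1 = true ∧ (formulaValue s next R.valuation φ).1 = false) := by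
  obtain ⟨μ, r, hμ, hr⟩ := P.exists_resolve hν
  obtain ⟨ρ', h1, h2, h3⟩ := h.exists_rigid
  obtain ⟨-, rfl, -⟩ := P.isDerivationTree.inner μ S r hr
  exact ⟨⟨σ, μ, r, ρ', hσ.trans hμ, hr, h1, h2⟩, rfl, h3⟩

/-- Combines a rule step, which keeps the chain, with the restoration of rigidity, which may leave
the chain of `s`. Monotonicity is therefore claimed only when the chain is unchanged. -/
theorem RefutedNode.exists_child (hse : s ≠ e)
    (hTeF : productionsFor Φ ⟨1, TeF⟩ = teFProductions TeF e next x)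
    (hFsT : productionsFor Φ ⟨1, FsT⟩ = fsTProductions FsT s next y)
    {P : PreProof B Φ} (hP : P.CutFree) (R : RefutedNode s next TeF FsT P) :
    ∃ (n : ℕ) (R' : RefutedNode s next TeF FsT P), R'.address = R.address ++ [n] ∧
      ∀ τ ∈ R.rule.conclusion.ante, ∀ τ', R.rule.TraceStep n τ τ' →
        ((formulaValue s next R'.valuation τ').1 = true →
          (formulaValue s next R.valuation τ).1 = true) ∧
        ((formulaValue s next R'.valuation τ').1 = (formulaValue s next R.valuation τ).1 →
          (formulaValue s next R.valuation τ).2 ≤ (formulaValue s next R'.valuation τ').2 ∧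
          (R.rule.Progress n τ τ' →
            (formulaValue s next R.valuation τ).2 <
              (formulaValue s next R'.valuation τ').2)) := by
  obtain ⟨hvalid, -, hprem⟩ := P.isDerivationTree.inner _ _ _ R.tree_eq
  obtain ⟨n, S', ρ', hS', href, hadv⟩ :=
    R.refutes.exists_premise hse hTeF hFsT hvalid (hP _ _ _ R.tree_eq)
  obtain ⟨R', hR', hval⟩ := href.exists_refutedNode (P := P) (σ := R.address ++ [n])
    (by rw [P.position_append_singleton, R.position_eq, Option.bind_some])
    ((hprem n).trans hS')
  refine ⟨n, R', hR', fun τ hτ τ' hstep => ?_⟩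
  obtain ⟨h1, h2, h3⟩ := hadv τ hτ τ' hstep
  rcases hval τ' with h | ⟨h, h'⟩
  · rw [h]
    exact ⟨fun ht => h1 ▸ ht, fun _ => ⟨h2, h3⟩⟩
  · rw [h1] at h
    rw [h, h']
    exact ⟨fun _ => rfl, fun hc => by simp at hc⟩

theorem not_cutFreeProvable_counterSequent (hse : s ≠ e)
    (hTeF : productionsFor Φ ⟨1, TeF⟩ = teFProductions TeF e next x)
    (hFsT : productionsFor Φ ⟨1, FsT⟩ = fsTProductions FsT s next y) :
    ¬ CutFreeProvable Φ (counterSequent TeF FsT s e) := by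
  rintro ⟨P, hroot, hproof, hcf⟩
  have hinit : Refutes s next (fun _ => (false, 0)) TeF FsT (counterSequent TeF FsT s e) := by
    constructor
    · intro φ hφ
      obtain rfl := Finset.mem_singleton.1 hφ
      exact ⟨rfl, by simp⟩
    · intro φ hφ
      obtain rfl := Finset.mem_singleton.1 hφ
      exact ⟨rfl, by simp [eval_constTm_of_ne _ _ _ _ hse]⟩
  obtain ⟨R₀, -, -⟩ := hinit.exists_refutedNode (P := P) (σ := []) rfl hroot
  choose dir child haddr hadv using
    fun R : RefutedNode s next TeF FsT P => R.exists_child hse hTeF hFsT hcf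
  let R : ℕ → RefutedNode s next TeF FsT P := fun i => child^[i] R₀
  have hR : ∀ i, R (i + 1) = child (R i) := fun i => Function.iterate_succ_apply' child i R₀
  have hunf : ∀ i, P.unfolding (R i).address = some ((R i).rule.conclusion, some (R i).rule) :=
    fun i => by rw [PreProof.unfolding, (R i).position_eq, Option.bind_some, (R i).tree_eq]
  obtain ⟨k, τ, htrace, hprog⟩ := hproof (fun i => (R i).address) (fun i => dir (R i))
    fun i => ⟨by simp [LTree.dom, hunf], by simp only [hR, haddr]⟩
  choose bound hbound using exists_bound_of_rigid s next TeF FsT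
  -- Finiteness of the pre-proof enters here: the infinite path visits finitely many sequents, so
  -- one `N` bounds all trace values.
  obtain ⟨N, hN⟩ := (P.finite_dom.image fun μ => (P.tree μ).elim 0 fun l => bound l.1).bddAbove
  have hstep : ∀ i, τ i ∈ (R (k + i)).rule.conclusion.ante ∧
      (R (k + i)).rule.TraceStep (dir (R (k + i))) (τ i) (τ (i + 1)) := fun i => by
    obtain ⟨S, r, hSr, -, hmem, hst⟩ := htrace i
    rw [hunf] at hSr
    cases hSr
    exact ⟨hmem, hst⟩
  refine not_frequently_increasing (fun i => formulaValue s next (R (k + i)).valuation (τ i))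
    (fun i => (R (k + i)).rule.Progress (dir (R (k + i))) (τ i) (τ (i + 1))) N
    (fun i => ?_) (fun i => ?_) (fun i => ?_) fun n => ?_
  · have := (hadv (R (k + i)) _ (hstep i).1 _ (hstep i).2).1
    rwa [← hR] at this
  · have := (hadv (R (k + i)) _ (hstep i).1 _ (hstep i).2).2
    rwa [← hR] at this
  · refine (hbound _ _ (R (k + i)).refutes (R (k + i)).rigid _ (hstep i).1).trans
      (hN ⟨(R (k + i)).node, ?_, ?_⟩)
    · simp [LTree.dom, (R (k + i)).tree_eq]
    · simp [(R (k + i)).tree_eq]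
  · obtain ⟨i, hi, S, r, hSr, hpr⟩ := hprog n
    rw [hunf] at hSr
    cases hSr
    exact ⟨i, hi, hpr⟩

end Countermodel

/-! ### Assembling finite derivation trees from subtrees -/

section TreeConstruction

variable {B : BaseLanguage.{u, v, w}} {Φ : IndDefSet B}

namespace LTree

/-- The tree that consists of a single bud. -/
def single (S : Sequent B) : LTree B
  | [] => some (S, none)
  | _ :: _ => none

/-- The tree with the rule application `r` at the root and the given immediate subtrees. -/
noncomputable def node (r : RuleApp B) (children : List (LTree B)) : LTree B
  | [] => some (r.conclusion, some r)
  | n :: σ => (children[n]?).bind fun D => D σ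

theorem single_eq_some {S : Sequent B} {σ : List ℕ} {l} :
    single S σ = some l ↔ σ = [] ∧ (S, none) = l := by
  cases σ <;> simp [single]

theorem node_nil_eq_some {r : RuleApp B} {σ : List ℕ} {l} :
    node r [] σ = some l ↔ σ = [] ∧ (r.conclusion, some r) = l := by
  cases σ <;> simp [node]

theorem node_singleton_eq_some {r : RuleApp B} {D : LTree B} {σ : List ℕ} {l} :
    node r [D] σ = some l ↔
      σ = [] ∧ (r.conclusion, some r) = l ∨ ∃ σ', σ = 0 :: σ' ∧ D σ' = some l := by
  rcases σ with _ | ⟨_ | n, σ⟩ <;> simp [node]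

theorem node_pair_eq_some {r : RuleApp B} {D₀ D₁ : LTree B} {σ : List ℕ} {l} :
    node r [D₀, D₁] σ = some l ↔
      σ = [] ∧ (r.conclusion, some r) = l ∨ (∃ σ', σ = 0 :: σ' ∧ D₀ σ' = some l) ∨
        ∃ σ', σ = 1 :: σ' ∧ D₁ σ' = some l := by
  rcases σ with _ | ⟨_ | _ | n, σ⟩ <;> simp [node]

/-- `D` is a finite derivation tree of `S` all of whose buds are labelled with `C`. -/
structure Derives (Φ : IndDefSet B) (C : Sequent B) (D : LTree B) (S : Sequent B) : Prop where
  isDerivationTree : D.IsDerivationTree Φ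
  finite_dom : D.dom.Finite
  root : D.sequentAt [] = some S
  buds : ∀ σ S', D σ = some (S', none) → S' = C

theorem derives_single (C : Sequent B) : Derives Φ C (single C) C where
  isDerivationTree :=
    { prefix_closed := fun σ₁ σ₂ h => by
        cases σ₁ with
        | nil => simp [dom, single]
        | cons n σ₁ => simp [dom, single] at h
      sibling_closed := fun σ n m h _ => by cases σ <;> simp [dom, single] at h
      bud := fun σ S _ => by cases σ <;> simp [dom, single]
      inner := fun σ S r h => by cases σ <;> simp [single] at h }
  finite_dom := (Set.finite_singleton []).subset fun σ h => by
    cases σ with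
    | nil => rfl
    | cons n σ => simp [dom, single] at h
  root := rfl
  buds := fun σ S' h => by
    cases σ with
    | nil => simpa [single, eq_comm] using h
    | cons n σ => simp [single] at h

theorem getElem?_of_forall₂ {C : Sequent B} {children : List (LTree B)} {prems : List (Sequent B)}
    (h : List.Forall₂ (Derives Φ C) children prems) (n : ℕ) :
    (children[n]? = none ∧ prems[n]? = none) ∨
      ∃ D S, children[n]? = some D ∧ prems[n]? = some S ∧ Derives Φ C D S := by
  induction h generalizing n with
  | nil => simp
  | cons h _ ih =>
    cases n with
    | zero => exact Or.inr ⟨_, _, rfl, rfl, h⟩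
    | succ n => simpa using ih n

theorem derives_node {C S : Sequent B} {r : RuleApp B} {children : List (LTree B)}
    {prems : List (Sequent B)} (hr : r.Valid Φ) (hS : r.conclusion = S) (hprems : r.premises = prems)
    (h : List.Forall₂ (Derives Φ C) children prems) : Derives Φ C (node r children) S := by
  subst hprems hS
  have hch := getElem?_of_forall₂ h
  have hcons : ∀ {n σ l}, node r children (n :: σ) = some l →
      ∃ D S, children[n]? = some D ∧ Derives Φ C D S ∧ D σ = some l := fun {n σ l} hl => by
    obtain ⟨D, hD, hl⟩ := Option.bind_eq_some_iff.1 hl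
    rcases hch n with ⟨hn, -⟩ | ⟨D', S, hD', -, hDS⟩
    · simp [hn] at hD
    · rw [hD'] at hD
      cases hD
      exact ⟨D, S, hD', hDS, hl⟩
  have hdom : ∀ {n σ}, n :: σ ∈ (node r children).dom →
      ∃ D S, children[n]? = some D ∧ Derives Φ C D S ∧ σ ∈ D.dom := fun {n σ} hσ => by
    obtain ⟨l, hl⟩ := Option.isSome_iff_exists.1 hσ
    obtain ⟨D, S, hD, hDS, hl⟩ := hcons hl
    exact ⟨D, S, hD, hDS, by simp [dom, hl]⟩
  have hnode : ∀ {n σ D}, children[n]? = some D → node r children (n :: σ) = D σ :=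
    fun {n σ D} hD => by simp [node, hD]
  refine ⟨⟨fun σ₁ σ₂ hσ => ?_, fun σ n m hσ hm => ?_, fun σ S hσ hσ' => ?_, fun σ S r' hσ => ?_⟩,
    ?_, rfl, fun σ S' hσ => ?_⟩
  · cases σ₁ with
    | nil => simp [dom, node]
    | cons n σ₁ =>
      obtain ⟨D, S, hD, hDS, hσ⟩ := hdom hσ
      simpa [dom, hnode hD] using hDS.isDerivationTree.prefix_closed _ _ hσ
  · cases σ with
    | nil =>
      obtain ⟨D, S, hD, -, -⟩ := hdom hσ
      rcases hch m with ⟨hm', -⟩ | ⟨D', S', hD', -, hDS'⟩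
      · have := List.getElem?_eq_none_iff.1 hm'
        have := (List.getElem?_eq_some_iff.1 hD).1
        lia
      · obtain ⟨l, hl, -⟩ := Option.map_eq_some_iff.1 hDS'.root
        simp [dom, hnode hD', hl]
    | cons k σ =>
      obtain ⟨D, S, hD, hDS, hσ⟩ := hdom hσ
      simpa [dom, hnode hD] using hDS.isDerivationTree.sibling_closed _ _ _ hσ hm
  · cases σ with
    | nil => simp [node] at hσ
    | cons k σ =>
      obtain ⟨D, S, hD, hDS, hσ⟩ := hcons hσ
      exact hDS.isDerivationTree.bud _ _ hσ (by simpa [dom, hnode hD] using hσ')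
  · cases σ with
    | nil =>
      simp only [node, Option.some.injEq, Prod.mk.injEq] at hσ
      obtain ⟨rfl, rfl⟩ := hσ
      refine ⟨hr, rfl, fun n => ?_⟩
      rcases hch n with ⟨h1, h2⟩ | ⟨D, S, hD, hS, hDS⟩
      · simp [sequentAt, node, h1, h2]
      · rw [hS, ← hDS.root]
        simp [sequentAt, hnode hD]
    | cons k σ =>
      obtain ⟨D, S, hD, hDS, hσ⟩ := hcons hσ
      obtain ⟨h1, h2, h3⟩ := hDS.isDerivationTree.inner _ _ _ hσ
      exact ⟨h1, h2, fun n => by rw [← h3 n]; simp [sequentAt, hnode hD]⟩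
  · have hfin : (⋃ n ∈ Set.Iio children.length,
        (fun σ => n :: σ) '' {σ | n :: σ ∈ (node r children).dom}).Finite := by
      refine (Set.finite_Iio _).biUnion fun n _ => Set.Finite.image _ ?_
      rcases hch n with ⟨hn, -⟩ | ⟨D, S, hD, -, hDS⟩
      · simp [dom, node, hn]
      · simpa [dom, hnode hD] using hDS.finite_dom
    refine ((Set.finite_singleton []).union hfin).subset fun σ hσ => ?_
    cases σ with
    | nil => exact Or.inl rfl
    | cons n σ =>
      obtain ⟨D, S, hD, -, -⟩ := hdom hσ
      exact Or.inr (Set.mem_biUnion (List.getElem?_eq_some_iff.1 hD).1 ⟨σ, hσ, rfl⟩)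
  · cases σ with
    | nil => simp [node] at hσ
    | cons k σ =>
      obtain ⟨D, S, hD, hDS, hσ⟩ := hcons hσ
      exact hDS.buds _ _ hσ

/-- A derivation tree with equally labelled buds is a pre-proof, given an inner node that can serve
as the companion of all buds. -/
def Derives.preProof {C S : Sequent B} {D : LTree B} (h : Derives Φ C D S) (c : List ℕ)
    (r : RuleApp B) (hc : D c = some (C, some r)) : PreProof B Φ where
  tree := D
  isDerivationTree := h.isDerivationTree
  finite_dom := h.finite_dom
  root_mem := by
    obtain ⟨l, hl, -⟩ := Option.map_eq_some_iff.1 h.root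
    simp [dom, hl]
  companion := fun _ => c
  companion_spec := fun σ ⟨S', hσ⟩ => by
    refine ⟨⟨C, r, hc⟩, ?_⟩
    obtain rfl := h.buds σ S' hσ
    simp [sequentAt, hc, hσ]

end LTree

end TreeConstruction

/-! ### The cyclic proof with cut -/

section CyclicProof

variable {B : BaseLanguage.{u, v, w}}

/-- The atomic formula `P(t)` as a formula. -/
def unaryFormula (P : B.Ind 1) (t : Tm B) : Formula B := .ind (unaryAtom P t)

theorem unaryFormula_subst (P : B.Ind 1) (t : Tm B) (θ : Substitution B) :
    (unaryFormula P t).subst θ = unaryFormula P (t.subst θ) := by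
  simp [unaryFormula, Formula.subst, unaryAtom_subst]

variable (TeF FsT : B.Ind 1) (s e : B.Functions 0) (next : B.Functions 1) (x y : ℕ)

/-- The case rule for `TeF(x)` in the sequent `TeF(x), FsT(x) ⊢ FsT(e)`. -/
noncomputable def loopCase : RuleApp B :=
  .case {unaryFormula FsT (.var 0)} {unaryFormula FsT (constTm e)} (unaryAtom TeF (.var 0))
    [(⟨[], [], unaryAtom TeF (constTm e)⟩, fun _ => 1),
     (⟨[], [unaryAtom TeF (appTm next (.var x))], unaryAtom TeF (.var x)⟩, fun _ => 1)]

/-- The sequent `TeF(x), FsT(x) ⊢ FsT(e)`. -/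
noncomputable def loopSequent : Sequent B :=
  ⟨{unaryFormula TeF (.var 0), unaryFormula FsT (.var 0)}, {unaryFormula FsT (constTm e)}⟩

/-- The antecedent `x = y, FsT(y), TeF(next y)`. -/
noncomputable def stepAnte : Finset (Formula B) :=
  {.eq (.var 0) (.var 1), unaryFormula FsT (.var 1), unaryFormula TeF (appTm next (.var 1))}

/-- The derivation of `x = e, FsT(x) ⊢ FsT(e)`. -/
noncomputable def baseBranch : LTree B :=
  -- Variable 2 marks the occurrence to rewrite; variable 3 occurs nowhere, so the rewriting goes in
  -- one direction only.
  .node (.eqLa {unaryFormula FsT (.var 2)} {unaryFormula FsT (constTm e)} 2 3 (.var 0) (constTm e))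
    [.node (.ax {.eq (.var 0) (constTm e), unaryFormula FsT (constTm e)}
      {unaryFormula FsT (constTm e)}) [] ]

/-- The derivation of `x = y, FsT(y), TeF(next y) ⊢ FsT(next y), FsT(e)`. -/
noncomputable def leftBranch : LTree B :=
  .node (.indR (stepAnte TeF FsT next) {unaryFormula FsT (constTm e)}
      ⟨[], [unaryAtom FsT (.var y)], unaryAtom FsT (appTm next (.var y))⟩ fun _ => .var 1)
    [.node (.ax (stepAnte TeF FsT next)
      {unaryFormula FsT (.var 1), unaryFormula FsT (constTm e)}) [] ]

/-- The derivation of `x = y, FsT(y), TeF(next y), FsT(next y) ⊢ FsT(e)` from the bud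
`TeF(x), FsT(x) ⊢ FsT(e)`. -/
noncomputable def rightBranch : LTree B :=
  .node (.weak {unaryFormula TeF (appTm next (.var 1)), unaryFormula FsT (appTm next (.var 1))}
      {unaryFormula FsT (constTm e)}
      (insert (unaryFormula FsT (appTm next (.var 1))) (stepAnte TeF FsT next))
      {unaryFormula FsT (constTm e)})
    [.node (.subst {unaryFormula TeF (.var 0), unaryFormula FsT (.var 0)}
        {unaryFormula FsT (constTm e)} fun _ => appTm next (.var 1))
      [.single (loopSequent TeF FsT e)] ]

/-- The derivation of `FsT(x), x = y, TeF(next y) ⊢ FsT(e)`. -/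
noncomputable def stepBranch : LTree B :=
  .node (.eqLa {unaryFormula FsT (.var 2), unaryFormula TeF (appTm next (.var 1))}
      {unaryFormula FsT (constTm e)} 2 3 (.var 0) (.var 1))
    [.node (.cut (stepAnte TeF FsT next) {unaryFormula FsT (constTm e)}
        (unaryFormula FsT (appTm next (.var 1))))
      [leftBranch TeF FsT e next y, rightBranch TeF FsT e next] ]

/-- The derivation of `FsT(s), TeF(s) ⊢ FsT(e)`. -/
noncomputable def mainBranch : LTree B :=
  .node (.subst {unaryFormula TeF (.var 0), unaryFormula FsT (.var 0)}
      {unaryFormula FsT (constTm e)} fun _ => constTm s)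
    [.node (loopCase TeF FsT e next x)
      [baseBranch FsT e, stepBranch TeF FsT e next y] ]

/-- The tree of the cyclic proof of `TeF(s) ⊢ FsT(e)`. -/
noncomputable def counterTree : LTree B :=
  .node (.cut {unaryFormula TeF (constTm s)} {unaryFormula FsT (constTm e)}
      (unaryFormula FsT (constTm s)))
    [.node (.indR {unaryFormula TeF (constTm s)} {unaryFormula FsT (constTm e)}
      ⟨[], [], unaryAtom FsT (constTm s)⟩ .var) [],
     mainBranch TeF FsT s e next x y]

variable {TeF FsT s e next x y} {Φ : IndDefSet B}

open LTree

theorem derives_baseBranch {C : Sequent B} : Derives Φ C (baseBranch FsT e)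
    ⟨{unaryFormula FsT (.var 0), .eq (.var 0) (constTm e)}, {unaryFormula FsT (constTm e)}⟩ := by
  refine derives_node (by simp [RuleApp.Valid]) ?_ ?_
    (.cons (derives_node ?_ rfl rfl .nil) .nil)
  · simp [RuleApp.conclusion, substSet, unaryFormula_subst, subst₂, Language.Term.subst,
      constTm_subst, Finset.pair_comm]
  · simp [RuleApp.premises, RuleApp.conclusion, substSet, unaryFormula_subst, subst₂,
      Language.Term.subst, constTm_subst]
  · exact ⟨_, by simp; rfl⟩

theorem derives_leftBranch {C : Sequent B}
    (hFsT : productionsFor Φ ⟨1, FsT⟩ = fsTProductions FsT s next y) :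
    Derives Φ C (leftBranch TeF FsT e next y)
      ⟨stepAnte TeF FsT next,
        {unaryFormula FsT (appTm next (.var 1)), unaryFormula FsT (constTm e)}⟩ := by
  refine derives_node ?_ ?_ ?_ (.cons (derives_node ?_ rfl rfl .nil) .nil)
  · exact (hFsT.ge (Set.mem_insert_of_mem _ rfl)).1
  · simp [RuleApp.conclusion, unaryFormula, unaryAtom_subst, appTm_subst, Language.Term.subst]
  · simp [RuleApp.premises, Production.asm, RuleApp.conclusion, unaryFormula, unaryAtom_subst,
      Language.Term.subst]
  · exact ⟨unaryFormula FsT (.var 1), by simp [stepAnte]⟩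

theorem derives_rightBranch : Derives Φ (loopSequent TeF FsT e) (rightBranch TeF FsT e next)
    ⟨insert (unaryFormula FsT (appTm next (.var 1))) (stepAnte TeF FsT next),
      {unaryFormula FsT (constTm e)}⟩ := by
  refine derives_node ⟨?_, subset_rfl⟩ rfl rfl
    (.cons (derives_node trivial ?_ rfl (.cons (derives_single _) .nil)) .nil)
  · intro φ
    simp only [stepAnte, Finset.mem_insert, Finset.mem_singleton]
    tauto
  · simp [RuleApp.conclusion, substSet, unaryFormula_subst, Language.Term.subst, constTm_subst]

theorem derives_stepBranch (hFsT : productionsFor Φ ⟨1, FsT⟩ = fsTProductions FsT s next y) :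
    Derives Φ (loopSequent TeF FsT e) (stepBranch TeF FsT e next y)
      ⟨{unaryFormula FsT (.var 0), .eq (.var 0) (.var 1),
        unaryFormula TeF (appTm next (.var 1))}, {unaryFormula FsT (constTm e)}⟩ := by
  refine derives_node (by simp [RuleApp.Valid]) ?_ ?_ (.cons (derives_node trivial rfl rfl
    (.cons (derives_leftBranch hFsT) (.cons derives_rightBranch .nil))) .nil)
  · simp [RuleApp.conclusion, substSet, unaryFormula_subst, subst₂, Language.Term.subst,
      constTm_subst, appTm_subst, Finset.insert_comm]
  · simp [RuleApp.premises, RuleApp.conclusion, substSet, unaryFormula_subst, subst₂,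
      Language.Term.subst, constTm_subst, appTm_subst, stepAnte]

theorem derives_mainBranch
    (hTeF : productionsFor Φ ⟨1, TeF⟩ = teFProductions TeF e next x)
    (hFsT : productionsFor Φ ⟨1, FsT⟩ = fsTProductions FsT s next y) :
    Derives Φ (loopSequent TeF FsT e) (mainBranch TeF FsT s e next x y)
      ⟨{unaryFormula FsT (constTm s), unaryFormula TeF (constTm s)},
        {unaryFormula FsT (constTm e)}⟩ := by
  refine derives_node trivial ?_ rfl (.cons (derives_node ⟨?_, fun p => ?_, ?_⟩ rfl ?_
    (.cons derives_baseBranch (.cons (derives_stepBranch hFsT) .nil))) .nil)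
  · simp [RuleApp.conclusion, substSet, unaryFormula_subst, Language.Term.subst, constTm_subst,
      Finset.pair_comm]
  · simp
  · rw [show (unaryAtom TeF (.var 0)).symbol = ⟨1, TeF⟩ from rfl, hTeF]
    simp [teFProductions]
  · have hfresh : 1 ∉ varsSet (insert (.ind (unaryAtom TeF (.var 0)))
        ({unaryFormula FsT (.var 0)} ∪ {unaryFormula FsT (constTm e)})) := by
      simp [varsSet, unaryFormula, Formula.vars, unaryAtom_vars, constTm_varFinset]
    intro c hc
    refine ⟨?_, ?_⟩
    -- Each production has at most one variable, so the constant renaming to variable 1 is injective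
    -- on it.
    · refine Set.Subsingleton.injOn (s := c.1.vars) ?_ _
      refine (Set.subsingleton_singleton (a := x)).anti ?_
      intro z hz
      simp only [List.mem_cons, List.not_mem_nil, or_false] at hc
      rcases hc with rfl | rfl
      · simp [Production.vars, unaryAtom_vars, constTm_varFinset] at hz
      · simpa [Production.vars, unaryAtom_vars, appTm_varFinset] using hz
    · simp only [List.mem_cons, List.not_mem_nil, or_false] at hc
      rcases hc with rfl | rfl <;> exact fun _ _ => hfresh
  · simp [RuleApp.premises, loopCase, Production.caseFormulas, Production.asm, unaryAtom_argList,
      unaryAtom_subst, constTm_subst, appTm_subst, Language.Term.subst, unaryFormula]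

theorem derives_counterTree
    (hTeF : productionsFor Φ ⟨1, TeF⟩ = teFProductions TeF e next x)
    (hFsT : productionsFor Φ ⟨1, FsT⟩ = fsTProductions FsT s next y) :
    Derives Φ (loopSequent TeF FsT e) (counterTree TeF FsT s e next x y)
      (counterSequent TeF FsT s e) := by
  refine derives_node trivial rfl rfl (.cons (derives_node ?_ ?_ rfl .nil)
    (.cons (derives_mainBranch hTeF hFsT) .nil))
  · exact (hFsT.ge (Set.mem_insert _ _)).1
  · simp [RuleApp.conclusion, unaryFormula, unaryAtom_subst, constTm_subst]

/-- Lists all addresses, with the single bud, so that walks through the unfolding become a finite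
combinatorial matter. -/
theorem counterTree_eq_some {σ : List ℕ} {S : Sequent B} {o : Option (RuleApp B)}
    (h : counterTree TeF FsT s e next x y σ = some (S, o)) :
    (o = none ∧ σ = [1, 0, 1, 0, 1, 0, 0]) ∨
    (o.isSome ∧ σ ∈ [ [], [0], [1], [1, 0], [1, 0, 0], [1, 0, 0, 0], [1, 0, 1], [1, 0, 1, 0],
      [1, 0, 1, 0, 0], [1, 0, 1, 0, 0, 0], [1, 0, 1, 0, 1], [1, 0, 1, 0, 1, 0] ]) := by
  simp only [counterTree, mainBranch, baseBranch, stepBranch, leftBranch, rightBranch,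
    node_nil_eq_some, node_singleton_eq_some, node_pair_eq_some, single_eq_some, Prod.mk.injEq] at h
  aesop

end CyclicProof

namespace PreProof

variable {B : BaseLanguage.{u, v, w}} {Φ : IndDefSet B} (P : PreProof B Φ)

theorem isInner_of_resolve {ν μ : List ℕ} (h : P.resolve ν = some μ) : P.tree.IsInner μ := by
  unfold resolve at h
  split at h
  · simp at h
  · rename_i S r hS
    cases h
    exact ⟨S, r, hS⟩
  · rename_i S hS
    cases h
    exact (P.companion_spec _ ⟨S, hS⟩).1

theorem isInner_of_position {σ μ : List ℕ} (h : P.position σ = some μ) : P.tree.IsInner μ := by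
  rcases List.eq_nil_or_concat σ with rfl | ⟨σ, n, rfl⟩
  · exact P.isInner_of_resolve h
  · rw [List.concat_eq_append, position_append_singleton] at h
    obtain ⟨ν, -, h⟩ := Option.bind_eq_some_iff.1 h
    exact P.isInner_of_resolve h

end PreProof

/-! ### The trace condition for the cyclic proof -/

section CyclicProof

variable {B : BaseLanguage.{u, v, w}} {TeF FsT : B.Ind 1} {s e : B.Functions 0}
  {next : B.Functions 1} {x y : ℕ} {Φ : IndDefSet B}

open LTree

/-- The edges of the cyclic proof through which the loop runs. -/
def loopEdges : List (List ℕ × ℕ × List ℕ) :=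
  [([1, 0], 1, [1, 0, 1]), ([1, 0, 1], 0, [1, 0, 1, 0]), ([1, 0, 1, 0], 1, [1, 0, 1, 0, 1]),
   ([1, 0, 1, 0, 1], 0, [1, 0, 1, 0, 1, 0]), ([1, 0, 1, 0, 1, 0], 0, [1, 0])]

/-- The edges of the cyclic proof. -/
def proofEdges : List (List ℕ × ℕ × List ℕ) :=
  loopEdges ++ [([], 0, [0]), ([], 1, [1]), ([1], 0, [1, 0]), ([1, 0], 0, [1, 0, 0]),
    ([1, 0, 0], 0, [1, 0, 0, 0]), ([1, 0, 1, 0], 0, [1, 0, 1, 0, 0]),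
    ([1, 0, 1, 0, 0], 0, [1, 0, 1, 0, 0, 0])]

theorem mem_proofEdges {P : PreProof B Φ} (hP : P.tree = counterTree TeF FsT s e next x y)
    (hc : P.companion = fun _ => [1, 0]) {μ μ' : List ℕ} {n : ℕ} (hμ : P.tree.IsInner μ)
    (h : P.resolve (μ ++ [n]) = some μ') : (μ, n, μ') ∈ proofEdges := by
  obtain ⟨S, r, hμ⟩ := hμ
  rw [hP] at hμ
  have hμ := counterTree_eq_some hμ
  simp only [reduceCtorEq, false_and, Option.isSome_some, true_and, false_or] at hμ
  have key : (μ ++ [n] = [1, 0, 1, 0, 1, 0, 0] ∧ μ' = [1, 0]) ∨ (μ' = μ ++ [n] ∧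
      μ ++ [n] ∈ [ [], [0], [1], [1, 0], [1, 0, 0], [1, 0, 0, 0], [1, 0, 1], [1, 0, 1, 0],
      [1, 0, 1, 0, 0], [1, 0, 1, 0, 0, 0], [1, 0, 1, 0, 1], [1, 0, 1, 0, 1, 0] ]) := by
    unfold PreProof.resolve at h
    rw [hP] at h
    split at h
    · simp at h
    · rename_i hS
      have := counterTree_eq_some hS
      cases h
      exact Or.inr ⟨rfl, by simpa using this⟩
    · rename_i hS
      have := counterTree_eq_some hS
      cases h
      left
      simpa [hc] using this
  simp only [List.mem_cons, List.not_mem_nil, or_false] at hμ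
  rcases hμ with rfl | rfl | rfl | rfl | rfl | rfl | rfl | rfl | rfl | rfl | rfl | rfl <;>
    simp at key <;> simp [proofEdges, loopEdges, key] <;> lia

/-- Two preceding edges rule out the approach from the root, and two following edges rule out the
branches that end in axioms. -/
theorem mem_loopEdges_of_walk : ∀ a ∈ proofEdges, ∀ b ∈ proofEdges, a.2.2 = b.1 →
    ∀ c ∈ proofEdges, b.2.2 = c.1 → ∀ d ∈ proofEdges, c.2.2 = d.1 →
    ∀ f ∈ proofEdges, d.2.2 = f.1 → c ∈ loopEdges := by
  decide

/-- The loop is a single cycle of length five, so five consecutive edges include the progressing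
one. -/
theorem exists_eq_of_loop_walk : ∀ a ∈ loopEdges, ∀ b ∈ loopEdges, a.2.2 = b.1 →
    ∀ c ∈ loopEdges, b.2.2 = c.1 → ∀ d ∈ loopEdges, c.2.2 = d.1 →
    ∀ f ∈ loopEdges, d.2.2 = f.1 →
      ([1, 0], 1, [1, 0, 1]) ∈ [a, b, c, d, f] := by
  decide

variable (TeF next) in
/-- The trace formula at the nodes of the loop. -/
noncomputable def loopTrace (μ : List ℕ) : Formula B :=
  if μ = [1, 0] then unaryFormula TeF (.var 0) else unaryFormula TeF (appTm next (.var 1))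

theorem loopTrace_step {μ μ' : List ℕ} {n : ℕ} (h : (μ, n, μ') ∈ loopEdges) :
    ∃ S r, counterTree TeF FsT s e next x y μ = some (S, some r) ∧
      loopTrace TeF next μ ∈ S.ante ∧
      r.TraceStep n (loopTrace TeF next μ) (loopTrace TeF next μ') ∧
      ((μ, n, μ') = ([1, 0], 1, [1, 0, 1]) →
        r.Progress n (loopTrace TeF next μ) (loopTrace TeF next μ')) := by
  have hprog : (loopCase TeF FsT e next x).Progress 1 (unaryFormula TeF (.var 0))
      (unaryFormula TeF (appTm next (.var 1))) :=
    ⟨rfl, _, rfl, _, List.mem_singleton_self _, by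
      simp [unaryFormula, unaryAtom_subst, appTm_subst, Language.Term.subst]⟩
  simp only [loopEdges, List.mem_cons, List.not_mem_nil, or_false, Prod.mk.injEq] at h
  rcases h with ⟨rfl, rfl, rfl⟩ | ⟨rfl, rfl, rfl⟩ | ⟨rfl, rfl, rfl⟩ | ⟨rfl, rfl, rfl⟩ |
    ⟨rfl, rfl, rfl⟩
  · exact ⟨_, _, rfl, Finset.mem_insert_self _ _, Or.inl hprog, fun _ => hprog⟩
  -- The rewritten variables 2 and 3 do not occur in the trace formula, which serves as its own
  -- template.
  · refine ⟨_, _, rfl, ?_, ⟨unaryFormula TeF (appTm next (.var 1)), ?_, ?_⟩, by simp⟩ <;>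
      simp [loopTrace, RuleApp.conclusion, substSet, unaryFormula_subst, appTm_subst,
        Language.Term.subst, subst₂]
  · refine ⟨_, _, rfl, ?_, ?_, by simp⟩ <;>
      simp [loopTrace, RuleApp.conclusion, RuleApp.TraceStep, stepAnte]
  · refine ⟨_, _, rfl, ?_, ?_, by simp⟩ <;>
      simp [loopTrace, RuleApp.conclusion, RuleApp.TraceStep, stepAnte]
  -- The substitution rule closes the loop: `TeF(next y)` is the instance of `TeF(x)`, the trace
  -- formula at the companion.
  · refine ⟨_, _, rfl, ?_, ?_, by simp⟩ <;>
      simp [loopTrace, RuleApp.conclusion, RuleApp.TraceStep, substSet, unaryFormula_subst,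
        Language.Term.subst]

theorem provable_counterSequent
    (hTeF : productionsFor Φ ⟨1, TeF⟩ = teFProductions TeF e next x)
    (hFsT : productionsFor Φ ⟨1, FsT⟩ = fsTProductions FsT s next y) :
    Provable Φ (counterSequent TeF FsT s e) := by
  have hD := derives_counterTree (Φ := Φ) hTeF hFsT
  let P : PreProof B Φ := hD.preProof [1, 0] (loopCase TeF FsT e next x) rfl
  refine ⟨P, hD.root, fun σ d hpath => ?_⟩
  have hpos : ∀ i, ∃ μ, P.position (σ i) = some μ := fun i => by
    obtain ⟨l, hl⟩ := Option.isSome_iff_exists.1 (hpath i).1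
    obtain ⟨μ, hμ, -⟩ := Option.bind_eq_some_iff.1 hl
    exact ⟨μ, hμ⟩
  choose μ hμ using hpos
  have hedge : ∀ i, (μ i, d i, μ (i + 1)) ∈ proofEdges := fun i => by
    refine mem_proofEdges (P := P) rfl rfl (P.isInner_of_position (hμ i)) ?_
    rw [← hμ (i + 1), (hpath i).2, P.position_append_singleton, hμ i, Option.bind_some]
  -- The edges from the root to the companion are the first two steps; dropping them leaves a path
  -- that runs round the loop.
  have hloop : ∀ i, (μ (2 + i), d (2 + i), μ (2 + (i + 1))) ∈ loopEdges := fun i => by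
    rw [show 2 + (i + 1) = i + 2 + 1 by lia, show 2 + i = i + 2 by lia]
    exact mem_loopEdges_of_walk _ (hedge i) _ (hedge (i + 1)) rfl _ (hedge (i + 2)) rfl _
      (hedge (i + 3)) rfl _ (hedge (i + 4)) rfl
  have hunf : ∀ i, P.unfolding (σ i) = counterTree TeF FsT s e next x y (μ i) := fun i => by
    rw [PreProof.unfolding, hμ, Option.bind_some]
    rfl
  refine ⟨2, fun i => loopTrace TeF next (μ (2 + i)), fun i => ?_, fun N => ?_⟩
  · obtain ⟨S, r, hS, h1, h2, -⟩ :=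
      loopTrace_step (FsT := FsT) (s := s) (e := e) (x := x) (y := y) (hloop i)
    refine ⟨S, r, by rw [hunf, hS], ?_, h1, h2⟩
    simp only [loopTrace, unaryFormula]
    split_ifs <;> exact ⟨_, rfl⟩
  · obtain ⟨i, hi, heq⟩ : ∃ i ≥ N,
        (μ (2 + i), d (2 + i), μ (2 + (i + 1))) = ([1, 0], 1, [1, 0, 1]) := by
      have := exists_eq_of_loop_walk _ (hloop N) _ (hloop (N + 1)) rfl _ (hloop (N + 2)) rfl _
        (hloop (N + 3)) rfl _ (hloop (N + 4)) rfl
      simp only [List.mem_cons, List.not_mem_nil, or_false] at this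
      rcases this with h | h | h | h | h
      exacts [⟨N, le_rfl, h.symm⟩, ⟨N + 1, by lia, h.symm⟩, ⟨N + 2, by lia, h.symm⟩,
        ⟨N + 3, by lia, h.symm⟩, ⟨N + 4, by lia, h.symm⟩]
    obtain ⟨S, r, hS, -, -, h3⟩ :=
      loopTrace_step (FsT := FsT) (s := s) (e := e) (x := x) (y := y) (hloop i)
    exact ⟨i, hi, S, r, by rw [hunf, hS], h3 heq⟩

end CyclicProof

end CyclicBase

theorem theorem1 (B : CyclicBase.BaseLanguage.{u, v, w}) (Φ : CyclicBase.IndDefSet B)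
    (s e : B.Functions 0) (next : B.Functions 1) (TeF FsT : B.Ind 1) (x y : ℕ)
    (hse : s ≠ e)
    (hTeF : CyclicBase.productionsFor Φ ⟨1, TeF⟩ = CyclicBase.teFProductions TeF e next x)
    (hFsT : CyclicBase.productionsFor Φ ⟨1, FsT⟩ = CyclicBase.fsTProductions FsT s next y) :
    CyclicBase.Provable Φ (CyclicBase.counterSequent TeF FsT s e) ∧
      ¬ CyclicBase.CutFreeProvable Φ (CyclicBase.counterSequent TeF FsT s e) :=
  ⟨CyclicBase.provable_counterSequent hTeF hFsT,
    CyclicBase.not_cutFreeProvable_counterSequent hse hTeF hFsT⟩
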